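/- Let $(R,\mu)$ be a $\sigma$-finite nonatomic measure space. For a nonnegative measurable function $g$ on $R$ (values in $[0,\infty]$) let $$g^*(t)=\inf\{\lambda\ge 0:\ \mu\{x\in R: g(x)>\lambda\}\le t\}\qquad(\inf\emptyset=\infty)$$ be its non-increasing rearrangement. For $1<p<\infty$ put $$\|g\|_{p,s}=\Big(\int_0^\infty \big(t^{1/p}g^*(t)\big)^s\,\frac{dt}{t}\Big)^{1/s}\ (1\le s<\infty),\qquad \|g\|_{p,\infty}=\sup_{t>0}t^{1/p}g^*(t),$$ and write $g\in L^{p,s}(R,\mu)$ if $\|g\|_{p,s}<\infty$. Let $1<p<s\le\infty$, $p'=p/(p-1)$, $s'=s/(s-1)$ ($s'=1$ if $s=\infty$), and $$c_{p,s}=\Big(\frac ps\Big)^{1/s}\Big(\frac{p'}{s'}\Big)^{1/s'},\qquad c_{p,\infty}=p'.$$ (i) Let $(Q,\nu)$ be a $\sigma$-finite measure space and let $f$ be a nonnegative measurable function on $(R\times Q,\mu\times\nu)$ such that for almost every $y\in Q$ the function $f_y(x)=f(x,y)$ belongs to $L^{p,s}(R,\mu)$. Set $F(x)=\int_Q f(x,y)\,d\nu(y)$.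 Then $F$ is $\mu$-measurable, $y\mapsto\|f_y\|_{p,s}$ is $\nu$-measurable, and $$\|F\|_{p,s}\le c_{p,s}\int_Q\|f_y\|_{p,s}\,d\nu(y).$$ (ii) The constant is optimal: if $\mu\neq0$, then for every $C<c_{p,s}$ there are a $\sigma$-finite measure space $(Q,\nu)$ and a nonnegative, finite-valued measurable function $f$ on $R\times Q$ with $f_y\in L^{p,s}(R,\mu)$ for almost every $y\in Q$ such that $$\|F\|_{p,s}> C\int_Q\|f_y\|_{p,s}\,d\nu(y).$$ -/

import Mathlib

open MeasureTheory Set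
open scoped ENNReal

universe u v

namespace LorentzSpace

/-- A measure is nonatomic if every measurable set of positive measure contains a measurable
subset of strictly smaller positive measure. -/
def IsNonatomic {R : Type*} [MeasurableSpace R] (μ : Measure R) : Prop :=
  ∀ A : Set R, MeasurableSet A → 0 < μ A →
    ∃ B : Set R, B ⊆ A ∧ MeasurableSet B ∧ 0 < μ B ∧ μ B < μ A

/-- The distribution function `l ↦ μ {f > l}` of a nonnegative function. -/
noncomputable def distribution {R : Type*} [MeasurableSpace R] (f : R → ℝ≥0∞) (μ : Measure R)
    (l : ℝ≥0∞) : ℝ≥0∞ :=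
  μ {x | l < f x}

/-- The non-increasing rearrangement `f*(t) = inf {l : μ {f > l} ≤ t}`, for `t ≥ 0`, of a
nonnegative function. -/
noncomputable def rearrangement {R : Type*} [MeasurableSpace R] (f : R → ℝ≥0∞) (μ : Measure R)
    (t : ℝ) : ℝ≥0∞ :=
  sInf {l : ℝ≥0∞ | distribution f μ l ≤ ENNReal.ofReal t}

/-- The Lorentz functional `‖f‖_{p,s} = (∫₀^∞ (t^{1/p} f*(t))^s dt/t)^{1/s}` of a nonnegative
function, with `‖f‖_{p,∞} = sup_{t > 0} t^{1/p} f*(t)`. -/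
noncomputable def lorentzNorm {R : Type*} [MeasurableSpace R] (f : R → ℝ≥0∞) (p : ℝ) (s : ℝ≥0∞)
    (μ : Measure R) : ℝ≥0∞ :=
  if s = ∞ then
    ⨆ t ∈ Ioi (0 : ℝ), ENNReal.ofReal t ^ (1 / p) * rearrangement f μ t
  else
    (∫⁻ t in Ioi (0 : ℝ),
      (ENNReal.ofReal t ^ (1 / p) * rearrangement f μ t) ^ s.toReal * ENNReal.ofReal (1 / t))
        ^ (1 / s.toReal)

/-- Membership of a nonnegative function in `L^{p,s}(R, μ)`. -/
def MemLorentz {R : Type*} [MeasurableSpace R] (f : R → ℝ≥0∞) (p : ℝ) (s : ℝ≥0∞)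
    (μ : Measure R) : Prop :=
  AEMeasurable f μ ∧ lorentzNorm f p s μ < ∞

/-- The constant `c_{p,s} = (p/s)^{1/s} (p'/s')^{1/s'}`; for `s = ∞` the first factor is
`1` and `s' = 1`, so that `c_{p,∞} = p'`. Here `p' = p / (p - 1)`. -/
noncomputable def lorentzConst (p : ℝ) (s : ℝ≥0∞) : ℝ :=
  if s = ∞ then p.conjExponent
  else (p / s.toReal) ^ (1 / s.toReal) *
    (p.conjExponent / s.toReal.conjExponent) ^ (1 / s.toReal.conjExponent)

end LorentzSpace

/-! Since `s > p`, the weight `t^{s/p-1}` is increasing and the Lorentz functional need not be a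
norm. The functional `f ↦ ∫₀ᵘ f*`, however, does satisfy Minkowski's integral inequality, because
`∫₀ᵘ f* = min_k (k u + ∫ (f - k)₊)`, with the minimum attained at `k = f*(u)`
(`lintegral_Ioc_rearrangement_lintegral_le`).

For `s = ∞` this gives the bound at once: `t F*(t) ≤ ∫₀ᵗ F*`, and `∫₀ᵗ u^{-1/p} du` produces the
factor `p'`. For `s = q < ∞` with conjugate exponent `r`, put `θ = r (1 - 1/p)` and `η = q/p`.
Summation by parts and Hölder show that `F*`, paired with any decreasing step function `g`, gives at
most `D (∫ g^r t^{θ-1})^{1/r}`, where `D = ∫ ‖f_y‖ dν`. To recover the norm of the decreasing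
function `h = F*` from such pairings, one would test with `φ = h^{q-1} t^{η-1}`, which need not
decrease. It is replaced by its level function `g`, equal on blocks to the average of `φ`: this does
not decrease the pairing with `h`, and it raises the dual norm by at most the Muckenhoupt constant
of the weights over intervals. That constant is exactly `c_{p,s}` (`rpow_sub_rpow_mul_le`,
`exists_antitone_pairing`, `lintegral_rpow_le_of_pairing`).

For optimality, a set of finite measure is cut into `n` equal pieces, and the sections are the
cyclic shifts of a step function approximating `t^{θ-1}`. Their sum is constant on the set, and the
ratio of the two sides tends to `c_{p,s}` as `n → ∞`. -/

namespace LorentzSpace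

/-! ### Rearrangements and Minkowski's inequality for `∫₀ᵘ f*`. -/

section Rearrangement

variable {R : Type*} [MeasurableSpace R] {μ : Measure R}

theorem distribution_anti (f : R → ℝ≥0∞) : Antitone (distribution f μ) := fun _ _ h =>
  measure_mono fun _ hx => lt_of_le_of_lt h hx

/-- The distribution function is right-continuous. -/
theorem exists_gt_lt_distribution {f : R → ℝ≥0∞} {l c : ℝ≥0∞} (h : c < distribution f μ l) :
    ∃ l', l < l' ∧ c < distribution f μ l' := by
  have hl : l < ∞ := by
    rcases eq_or_ne l ∞ with rfl | hl
    · simp [distribution] at h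
    · exact hl.lt_top
  obtain ⟨r, ranti, hr, hlim⟩ := exists_seq_strictAnti_tendsto' hl
  have hU : {x | l < f x} = ⋃ n, {x | r n < f x} := by
    ext x
    simp only [mem_ofPred_eq, mem_iUnion]
    constructor
    · intro hx
      exact ((hlim.eventually_lt_const hx).exists)
    · rintro ⟨n, hn⟩
      exact (hr n).1.trans hn
  have hmono : Monotone fun n => {x | r n < f x} := fun m n hmn x hx =>
    lt_of_le_of_lt (ranti.antitone hmn) hx
  rw [distribution, hU, hmono.measure_iUnion, lt_iSup_iff] at h
  obtain ⟨n, hn⟩ := h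
  exact ⟨r n, (hr n).1, hn⟩

/-- Right-continuity of the distribution function makes the infimum attained, so statements about
`f*` translate exactly into statements about level sets. -/
theorem lt_rearrangement_iff {f : R → ℝ≥0∞} {t : ℝ} {l : ℝ≥0∞} :
    l < rearrangement f μ t ↔ ENNReal.ofReal t < distribution f μ l := by
  constructor
  · intro h
    by_contra! h'
    exact absurd (sInf_le (a := l) h') (not_le.2 h)
  · intro h
    obtain ⟨l', hl', h'⟩ := exists_gt_lt_distribution h
    refine hl'.trans_le (le_sInf fun k hk => ?_)
    by_contra! hk'
    exact absurd (h'.trans_le (distribution_anti f hk'.le)) (not_lt.2 hk)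

theorem rearrangement_le_iff {f : R → ℝ≥0∞} {t : ℝ} {l : ℝ≥0∞} :
    rearrangement f μ t ≤ l ↔ distribution f μ l ≤ ENNReal.ofReal t := by
  rw [← not_lt, lt_rearrangement_iff, not_lt]

theorem rearrangement_antitone (f : R → ℝ≥0∞) : Antitone (rearrangement f μ) := fun _ _ h =>
  rearrangement_le_iff.2 ((rearrangement_le_iff.1 le_rfl).trans (ENNReal.ofReal_le_ofReal h))

theorem measurable_rearrangement (f : R → ℝ≥0∞) : Measurable (rearrangement f μ) :=
  (rearrangement_antitone f).measurable

theorem rearrangement_congr {f g : R → ℝ≥0∞} (h : f =ᵐ[μ] g) :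
    rearrangement f μ = rearrangement g μ := by
  have : distribution f μ = distribution g μ := by
    ext l
    refine measure_congr ?_
    filter_upwards [h] with x hx
    change (l < f x) = (l < g x)
    rw [hx]
  ext t
  rw [rearrangement, rearrangement, this]

theorem lorentzNorm_congr {f g : R → ℝ≥0∞} (h : f =ᵐ[μ] g) (p : ℝ) (s : ℝ≥0∞) :
    lorentzNorm f p s μ = lorentzNorm g p s μ := by
  rw [lorentzNorm, lorentzNorm, rearrangement_congr h]

/-- With `c = f x` this yields the layer-cake formula; with `c = μ {f > l}` it yields the
equimeasurability of `f` and `f*`. -/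
theorem volume_Ioi_zero_inter_ofReal_lt (c : ℝ≥0∞) :
    volume ({t : ℝ | ENNReal.ofReal t < c} ∩ Ioi 0) = c := by
  rcases eq_or_ne c ∞ with rfl | hc
  · have : {t : ℝ | ENNReal.ofReal t < ∞} ∩ Ioi 0 = Ioi 0 := by ext; simp
    rw [this, Real.volume_Ioi]
  · have : {t : ℝ | ENNReal.ofReal t < c} ∩ Ioi 0 = Ioo 0 c.toReal := by
      ext t
      simp only [mem_inter_iff, mem_ofPred_eq, mem_Ioi, mem_Ioo]
      constructor
      · rintro ⟨h, h0⟩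
        exact ⟨h0, (ENNReal.ofReal_lt_iff_lt_toReal h0.le hc).1 h⟩
      · rintro ⟨h0, h⟩
        exact ⟨(ENNReal.ofReal_lt_iff_lt_toReal h0.le hc).2 h, h0⟩
    rw [this, Real.volume_Ioo, sub_zero, ENNReal.ofReal_toReal hc]

/-- The layer-cake formula for functions with values in `[0, ∞]`. -/
theorem lintegral_eq_lintegral_distribution [SFinite μ] {f : R → ℝ≥0∞} (hf : Measurable f) :
    ∫⁻ x, f x ∂μ = ∫⁻ l in Ioi (0 : ℝ), distribution f μ (ENNReal.ofReal l) := by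
  have hS : MeasurableSet {z : R × ℝ | ENNReal.ofReal z.2 < f z.1} :=
    measurableSet_lt (ENNReal.measurable_ofReal.comp measurable_snd) (hf.comp measurable_fst)
  have h1 := Measure.prod_apply (μ := μ) (ν := (volume : Measure ℝ).restrict (Ioi 0)) hS
  have h2 := Measure.prod_apply_symm (μ := μ) (ν := (volume : Measure ℝ).restrict (Ioi 0)) hS
  rw [h1] at h2
  refine Eq.trans (lintegral_congr fun x => ?_) h2
  rw [Measure.restrict_apply (measurable_prodMk_left hS)]
  exact (volume_Ioi_zero_inter_ofReal_lt (f x)).symm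

/-- Truncation from below commutes with rearrangement, in integrated form. -/
theorem lintegral_rearrangement_tsub [SFinite μ] {f : R → ℝ≥0∞} (hf : Measurable f) (k : ℝ≥0∞) :
    ∫⁻ t in Ioi (0 : ℝ), (rearrangement f μ t - k) = ∫⁻ x, (f x - k) ∂μ := by
  rw [lintegral_eq_lintegral_distribution ((measurable_rearrangement f).sub_const k),
    lintegral_eq_lintegral_distribution (hf.sub_const k)]
  refine lintegral_congr fun l => ?_
  simp only [distribution, lt_tsub_iff_right]
  rw [Measure.restrict_apply (measurableSet_lt measurable_const (measurable_rearrangement f))]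
  simp only [lt_rearrangement_iff]
  rw [volume_Ioi_zero_inter_ofReal_lt]
  rfl

/-- Every level `k` gives an upper bound for `∫₀ᵘ f*`; the next lemma shows that `k = f*(u)` gives
equality. -/
theorem lintegral_Ioc_rearrangement_le [SFinite μ] {f : R → ℝ≥0∞} (hf : Measurable f)
    (u : ℝ) (k : ℝ≥0∞) :
    ∫⁻ t in Ioc 0 u, rearrangement f μ t ≤ k * ENNReal.ofReal u + ∫⁻ x, (f x - k) ∂μ := by
  calc ∫⁻ t in Ioc 0 u, rearrangement f μ t
      ≤ ∫⁻ t in Ioc 0 u, (k + (rearrangement f μ t - k)) :=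
        lintegral_mono fun t => le_add_tsub
    _ = k * ENNReal.ofReal u + ∫⁻ t in Ioc 0 u, (rearrangement f μ t - k) := by
        rw [lintegral_add_left measurable_const]
        simp
    _ ≤ _ := by
        gcongr
        rw [← lintegral_rearrangement_tsub hf]
        exact lintegral_mono_set Ioc_subset_Ioi_self

theorem lintegral_Ioc_rearrangement_eq [SFinite μ] {f : R → ℝ≥0∞} (hf : Measurable f)
    {u : ℝ} (hu : 0 < u) :
    rearrangement f μ u * ENNReal.ofReal u + ∫⁻ x, (f x - rearrangement f μ u) ∂μ =
      ∫⁻ t in Ioc 0 u, rearrangement f μ t := by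
  rw [← lintegral_rearrangement_tsub hf, ← Ioc_union_Ioi_eq_Ioi hu.le,
    lintegral_union measurableSet_Ioi (Ioc_disjoint_Ioi le_rfl)]
  have h0 : ∫⁻ t in Ioi u, (rearrangement f μ t - rearrangement f μ u) = 0 := by
    rw [setLIntegral_congr_fun (g := fun _ => 0) measurableSet_Ioi]
    · simp
    · intro t ht
      exact tsub_eq_zero_of_le (rearrangement_antitone f (le_of_lt ht))
  rw [h0, add_zero]
  have h1 : ∫⁻ _ in Ioc 0 u, rearrangement f μ u = rearrangement f μ u * ENNReal.ofReal u := by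
    simp
  rw [← h1, ← lintegral_add_left measurable_const]
  refine setLIntegral_congr_fun measurableSet_Ioc fun t ht => ?_
  exact add_tsub_cancel_of_le (rearrangement_antitone f ht.2)

variable {Q : Type*} [MeasurableSpace Q] {ν : Measure Q}

/-- Joint measurability of the rearrangement of the sections. -/
theorem measurable_rearrangement_section [SFinite μ] {f : R × Q → ℝ≥0∞} (hf : Measurable f) :
    Measurable fun z : Q × ℝ => rearrangement (fun x => f (x, z.1)) μ z.2 := by
  refine measurable_of_Iic fun l => ?_
  have : (fun z : Q × ℝ => rearrangement (fun x => f (x, z.1)) μ z.2) ⁻¹' Iic l =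
      {z : Q × ℝ | distribution (fun x => f (x, z.1)) μ l ≤ ENNReal.ofReal z.2} := by
    ext z
    exact rearrangement_le_iff
  rw [this]
  have hd : Measurable fun y : Q => distribution (fun x => f (x, y)) μ l :=
    measurable_measure_prodMk_right (measurableSet_lt measurable_const hf)
  exact measurableSet_le (hd.comp measurable_fst) (ENNReal.measurable_ofReal.comp measurable_snd)

/-- `F ↦ ∫₀ᵘ F*` satisfies Minkowski's integral inequality. -/
theorem lintegral_Ioc_rearrangement_lintegral_le [SFinite μ] [SFinite ν] {f : R × Q → ℝ≥0∞}
    (hf : Measurable f) {u : ℝ} (hu : 0 < u) :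
    ∫⁻ t in Ioc 0 u, rearrangement (fun x => ∫⁻ y, f (x, y) ∂ν) μ t ≤
      ∫⁻ y, (∫⁻ t in Ioc 0 u, rearrangement (fun x => f (x, y)) μ t) ∂ν := by
  have hk : Measurable fun y : Q => rearrangement (fun x => f (x, y)) μ u :=
    (measurable_rearrangement_section hf).comp measurable_prodMk_right
  have hsub : Measurable fun z : R × Q => f z - rearrangement (fun x => f (x, z.2)) μ u :=
    hf.sub (hk.comp measurable_snd)
  -- The level used for `F` is the integral of the optimal levels `f_y*(u)`; what remains is that
  -- the positive part of an integral is at most the integral of the positive parts.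
  refine (lintegral_Ioc_rearrangement_le hf.lintegral_prod_right' u
    (∫⁻ y, rearrangement (fun x => f (x, y)) μ u ∂ν)).trans ?_
  have h1 : ∫⁻ x, (∫⁻ y, f (x, y) ∂ν - ∫⁻ y, rearrangement (fun x => f (x, y)) μ u ∂ν) ∂μ ≤
      ∫⁻ y, ∫⁻ x, (f (x, y) - rearrangement (fun x => f (x, y)) μ u) ∂μ ∂ν := by
    rw [lintegral_lintegral_swap (f := fun y x => f (x, y) - rearrangement (fun x => f (x, y)) μ u)
      (hsub.comp measurable_swap).aemeasurable]
    refine lintegral_mono fun x => ?_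
    rw [tsub_le_iff_left, ← lintegral_add_left hk]
    exact lintegral_mono fun y => le_add_tsub
  refine (add_le_add_right h1 _).trans ?_
  rw [← lintegral_mul_const _ hk, ← lintegral_add_left (hk.mul_const _)]
  refine lintegral_mono fun y => ?_
  exact (lintegral_Ioc_rearrangement_eq (hf.comp measurable_prodMk_right) hu).le

/-- In the supremum defining the weak norm it suffices to consider rational times. -/
theorem lorentzNorm_top_eq (f : R → ℝ≥0∞) {p : ℝ} (hp : 0 < p) :
    lorentzNorm f p ∞ μ = ⨆ q : {q : ℚ // 0 < q},
      ENNReal.ofReal (q : ℚ) ^ (1 / p) * rearrangement f μ (q : ℚ) := by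
  rw [lorentzNorm, if_pos rfl]
  apply le_antisymm
  · refine iSup₂_le fun t ht => ?_
    have ht0 : (0 : ℝ) < t := ht
    refine ENNReal.le_of_forall_lt_one_mul_le fun a ha => ?_
    rcases eq_or_ne a 0 with rfl | ha0
    · simp
    have hb : a ^ p < 1 := ENNReal.rpow_lt_one ha hp
    have hb' : (a ^ p).toReal < 1 := by
      simpa using (ENNReal.toReal_lt_toReal hb.ne_top ENNReal.one_ne_top).2 hb
    -- A rational `q` in `(a^p t, t)` loses at most the factor `a` in `t^{1/p}`, while `f*(q) ≥
    -- f*(t)`.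
    obtain ⟨q, hq1, hq2⟩ := exists_rat_btwn (show (a ^ p).toReal * t < t by nlinarith)
    have hq0 : (0 : ℝ) < q := lt_of_le_of_lt (by positivity) hq1
    refine le_trans ?_ (le_iSup _ (⟨q, by exact_mod_cast hq0⟩ : {q : ℚ // 0 < q}))
    rw [← mul_assoc]
    gcongr ?_ * ?_
    · have : a = (a ^ p) ^ (1 / p) := by
        rw [← ENNReal.rpow_mul, mul_one_div_cancel hp.ne', ENNReal.rpow_one]
      conv_lhs => rw [this]
      rw [← ENNReal.mul_rpow_of_nonneg _ _ (by positivity)]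
      gcongr
      rw [← ENNReal.ofReal_toReal hb.ne_top, ← ENNReal.ofReal_mul ENNReal.toReal_nonneg]
      exact ENNReal.ofReal_le_ofReal hq1.le
    · exact rearrangement_antitone f hq2.le
  · exact iSup_le fun q => le_iSup₂_of_le (q : ℝ) (by simpa using q.2) le_rfl

theorem measurable_lorentzNorm_section [SFinite μ] {f : R × Q → ℝ≥0∞} (hf : Measurable f)
    {p : ℝ} (hp : 0 < p) (s : ℝ≥0∞) :
    Measurable fun y => lorentzNorm (fun x => f (x, y)) p s μ := by
  have hr := measurable_rearrangement_section (μ := μ) hf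
  rcases eq_or_ne s ∞ with rfl | hs
  · simp_rw [lorentzNorm_top_eq _ hp]
    exact Measurable.iSup fun q =>
      (hr.comp (measurable_prodMk_right (y := ((q : ℚ) : ℝ)))).const_mul _
  · simp only [lorentzNorm, if_neg hs]
    refine Measurable.pow_const ?_ _
    refine Measurable.lintegral_prod_right' (ν := (volume : Measure ℝ).restrict (Ioi 0))
      (f := fun z : Q × ℝ => (ENNReal.ofReal z.2 ^ (1 / p) *
        rearrangement (fun x => f (x, z.1)) μ z.2) ^ s.toReal * ENNReal.ofReal (1 / z.2)) ?_
    refine ((Measurable.mul ?_ hr).pow_const _).mul ?_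
    · exact (ENNReal.measurable_ofReal.comp measurable_snd).pow_const _
    · exact ENNReal.measurable_ofReal.comp (measurable_const.div measurable_snd)

end Rearrangement

/-! ### Level sequences and the discrete Muckenhoupt estimate. -/

section Sequences

/-- Least decreasing majorization of a finite sequence (pooling of adjacent violators): the
sequence `g` is blockwise the average of `φ`. -/
theorem exists_level_sequence (n : ℕ) : ∀ φ : ℕ → ℝ, (∀ i, 0 ≤ φ i) →
    ∃ g : ℕ → ℝ, Antitone g ∧ (∀ i, 0 ≤ g i) ∧ (∀ i, n ≤ i → g i = 0) ∧
      (0 < n → ∃ k, 0 < k ∧ k ≤ n ∧ g 0 * k = ∑ i ∈ Finset.range k, φ i) ∧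
      (∀ j ≤ n, ∑ i ∈ Finset.range j, φ i ≤ ∑ i ∈ Finset.range j, g i) ∧
      ∀ (Φ : ℕ → ℝ → ℝ) (Ψ : ℕ → ℝ),
        (∀ a k, 0 < k → a + k ≤ n →
          ∑ i ∈ Finset.range k, Φ (a + i) ((∑ i ∈ Finset.range k, φ (a + i)) / k) ≤
            ∑ i ∈ Finset.range k, Ψ (a + i)) →
        ∑ i ∈ Finset.range n, Φ i (g i) ≤ ∑ i ∈ Finset.range n, Ψ i := by
  induction n using Nat.strong_induction_on with
  | _ n ih =>
  intro φ hφ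
  rcases Nat.eq_zero_or_pos n with rfl | hn
  · exact ⟨fun _ => 0, antitone_const, fun _ => le_rfl, fun _ _ => rfl, by simp, by simp, by simp⟩
  -- The first block is the initial segment of largest average; the induction hypothesis treats the
  -- rest.
  obtain ⟨j, hj, hmax⟩ := Finset.exists_max_image (Finset.Icc 1 n)
    (fun j => (∑ i ∈ Finset.range j, φ i) / (j : ℝ)) ⟨1, by simp; omega⟩
  rw [Finset.mem_Icc] at hj
  set A := (∑ i ∈ Finset.range j, φ i) / (j : ℝ) with hA
  have hj0 : (0 : ℝ) < j := by exact_mod_cast hj.1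
  have hAj : A * j = ∑ i ∈ Finset.range j, φ i := div_mul_cancel₀ _ hj0.ne'
  have hA0 : 0 ≤ A := div_nonneg (Finset.sum_nonneg fun i _ => hφ i) hj0.le
  have hle : ∀ m ≤ n, ∑ i ∈ Finset.range m, φ i ≤ A * m := by
    intro m hm
    rcases Nat.eq_zero_or_pos m with rfl | hm0
    · simp
    · have := hmax m (Finset.mem_Icc.2 ⟨hm0, hm⟩)
      rwa [div_le_iff₀ (by exact_mod_cast hm0)] at this
  obtain ⟨g, ganti, g0, gz, gk, gsum, gΦ⟩ :=
    ih (n - j) (by omega) (fun i => φ (j + i)) (fun i => hφ _)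
  -- The value `g 0` is itself an average over an initial segment of the remainder. Were it larger
  -- than `A`, joining that segment to the first block would beat the maximal average.
  have hgA : g 0 ≤ A := by
    rcases Nat.eq_zero_or_pos (n - j) with h | h
    · rw [gz 0 (by omega)]
      exact hA0
    · obtain ⟨k, hk0, hk, hgk⟩ := gk h
      have h1 := hle (j + k) (by omega)
      rw [Finset.sum_range_add, ← hAj, ← hgk] at h1
      push_cast at h1
      have hk0' : (0 : ℝ) < k := by exact_mod_cast hk0
      by_contra! hlt
      nlinarith
  set G : ℕ → ℝ := fun i => if i < j then A else g (i - j) with hG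
  have hG1 : ∀ i, i < j → G i = A := fun i hi => if_pos hi
  have hG2 : ∀ i, G (j + i) = g i := fun i => by simp [hG]
  have hsplit : ∀ k, ∑ i ∈ Finset.range (j + k), G i = A * j + ∑ i ∈ Finset.range k, g i := by
    intro k
    rw [Finset.sum_range_add]
    simp only [hG2]
    rw [Finset.sum_congr rfl fun i hi => hG1 i (Finset.mem_range.1 hi)]
    simp [mul_comm]
  refine ⟨G, ?_, ?_, ?_, ?_, ?_, ?_⟩
  · intro a b hab
    simp only [hG]
    split_ifs with h1 h2 h2
    · exact le_rfl
    · omega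
    · exact (ganti (Nat.zero_le _)).trans hgA
    · exact ganti (by omega)
  · intro i
    simp only [hG]
    split_ifs
    exacts [hA0, g0 _]
  · intro i hi
    simp only [hG]
    rw [if_neg (by omega), gz _ (by omega)]
  · exact fun _ => ⟨j, hj.1, hj.2, by rw [hG1 0 hj.1, hAj]⟩
  · intro m hm
    rcases le_total m j with h | h
    · rw [Finset.sum_congr rfl fun i hi => hG1 i ((Finset.mem_range.1 hi).trans_le h)]
      simpa [mul_comm] using hle m hm
    · obtain ⟨k, rfl⟩ := Nat.exists_eq_add_of_le h
      rw [hsplit, Finset.sum_range_add, ← hAj]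
      exact add_le_add_right (gsum k (by omega)) _
  -- The blocks stay hidden: an estimate known for the average of `φ` over every interval is summed
  -- over the blocks of `g`.
  · intro Φ Ψ H
    obtain ⟨k, rfl⟩ := Nat.exists_eq_add_of_le hj.2
    rw [Finset.sum_range_add, Finset.sum_range_add]
    refine add_le_add ?_ ?_
    · rw [Finset.sum_congr rfl fun i hi => by rw [hG1 i (Finset.mem_range.1 hi)]]
      simpa using H 0 j hj.1 (by omega)
    · simp only [hG2]
      have := gΦ (fun i => Φ (j + i)) (fun i => Ψ (j + i)) (fun a l hl hal => by
        have := H (j + a) l hl (by omega)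
        simpa only [add_assoc] using this)
      simpa using this

/-- Abel summation against a decreasing sequence. -/
theorem sum_mul_le_sum_mul_of_antitone {n : ℕ} {h φ g : ℕ → ℝ} (hh : Antitone h)
    (h0 : ∀ i, 0 ≤ h i)
    (H : ∀ j ≤ n, ∑ i ∈ Finset.range j, φ i ≤ ∑ i ∈ Finset.range j, g i) :
    ∑ i ∈ Finset.range n, h i * φ i ≤ ∑ i ∈ Finset.range n, h i * g i := by
  -- The boundary term is kept so that the induction closes; it is nonnegative and is dropped at the
  -- end.
  have key : ∀ m, m + 1 ≤ n →
      h m * (∑ i ∈ Finset.range (m + 1), g i - ∑ i ∈ Finset.range (m + 1), φ i) ≤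
        ∑ i ∈ Finset.range (m + 1), h i * g i - ∑ i ∈ Finset.range (m + 1), h i * φ i := by
    intro m
    induction m with
    | zero => intro _; simp [mul_sub]
    | succ m ih =>
      intro hm
      have h1 := ih (by omega)
      have h2 := H (m + 1) (by omega)
      have h3 := hh (Nat.le_succ m)
      rw [Finset.sum_range_succ _ (m + 1), Finset.sum_range_succ _ (m + 1),
        Finset.sum_range_succ _ (m + 1), Finset.sum_range_succ _ (m + 1)]
      simp only [Nat.succ_eq_add_one] at h3
      nlinarith [mul_le_mul_of_nonneg_right h3 (sub_nonneg.2 h2)]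
  rcases n with _ | n
  · simp
  · have h1 := key n le_rfl
    have h2 := mul_nonneg (h0 n) (sub_nonneg.2 (H (n + 1) le_rfl))
    linarith

/-- The Muckenhoupt inequality for power weights on intervals, with its sharp constant. -/
theorem rpow_sub_rpow_mul_le {A B θ η q : ℝ} (hA : 0 ≤ A) (hAB : A ≤ B) (hθ : 0 < θ) (hη : 0 < η)
    (hq : 1 < q) (h : (q - 1) * θ + η = q) :
    (B ^ θ - A ^ θ) ^ (q - 1) * (B ^ η - A ^ η) ≤ (B - A) ^ q := by
  have hB : 0 ≤ B := hA.trans hAB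
  have hq0 : 0 < q := by linarith
  have hc : (q / (q - 1)).HolderConjugate q := (Real.HolderConjugate.conjExponent hq).symm
  have hX : 0 ≤ B ^ θ - A ^ θ := sub_nonneg.2 (Real.rpow_le_rpow hA hAB hθ.le)
  have hY : 0 ≤ B ^ η - A ^ η := sub_nonneg.2 (Real.rpow_le_rpow hA hAB hη.le)
  have hinv : 1 / (q / (q - 1)) = (q - 1) / q := by rw [one_div_div]
  have e1 : (q - 1) / q * (q / (q - 1)) = 1 := by
    have : q - 1 ≠ 0 := by linarith
    field_simp
  -- Two-term Hölder for `B^θ = (B^θ - A^θ) + A^θ` and `B^η = (B^η - A^η) + A^η`. The relation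
  -- between `θ` and `η` makes the second product `A` and the right side `B`.
  have hold := Real.inner_le_Lp_mul_Lq_of_nonneg (Finset.univ : Finset (Fin 2)) hc
    (f := ![(B ^ θ - A ^ θ) ^ ((q - 1) / q), (A ^ θ) ^ ((q - 1) / q)])
    (g := ![(B ^ η - A ^ η) ^ (1 / q), (A ^ η) ^ (1 / q)])
    (by intro i _; fin_cases i <;> simp <;> positivity)
    (by intro i _; fin_cases i <;> simp <;> positivity)
  simp only [Fin.sum_univ_two, Matrix.cons_val_zero, Matrix.cons_val_one] at hold
  rw [hinv, ← Real.rpow_mul hX, ← Real.rpow_mul hY, ← Real.rpow_mul (Real.rpow_nonneg hA θ) _ _,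
    ← Real.rpow_mul (Real.rpow_nonneg hA η) _ _, e1, one_div_mul_cancel hq0.ne'] at hold
  simp only [Real.rpow_one, sub_add_cancel] at hold
  have hcomb : ∀ x : ℝ, 0 ≤ x → (x ^ θ) ^ ((q - 1) / q) * (x ^ η) ^ (1 / q) = x := by
    intro x hx
    have e2 : θ * ((q - 1) / q) + η * (1 / q) = 1 := by
      field_simp
      linarith
    rw [← Real.rpow_mul hx, ← Real.rpow_mul hx, ← Real.rpow_add' hx (by rw [e2]; exact one_ne_zero),
      e2, Real.rpow_one]
  rw [hcomb A hA, hcomb B hB] at hold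
  have h1 : (B ^ θ - A ^ θ) ^ ((q - 1) / q) * (B ^ η - A ^ η) ^ (1 / q) ≤ B - A := by linarith
  have h2 := Real.rpow_le_rpow (by positivity) h1 hq0.le
  rwa [Real.mul_rpow (by positivity) (by positivity), ← Real.rpow_mul hX, ← Real.rpow_mul hY,
    div_mul_cancel₀ _ hq0.ne', one_div_mul_cancel hq0.ne', Real.rpow_one] at h2

/-- A weighted `ℓ^q` norm of a decreasing sequence is controlled by pairing with a decreasing
sequence, up to the Muckenhoupt constant of the weight. -/
theorem exists_antitone_pairing {q r δ K : ℝ} (hqr : q.HolderConjugate r) (hδ : 0 < δ)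
    (hK : 0 ≤ K) {V W h : ℕ → ℝ} (hV : ∀ i, 0 ≤ V i) (hW : ∀ i, 0 ≤ W i)
    (hA : ∀ a k, 0 < k → (∑ i ∈ Finset.range k, W (a + i)) ^ (q - 1) *
      ∑ i ∈ Finset.range k, V (a + i) ≤ (K * (k * δ)) ^ q)
    (hh : Antitone h) (h0 : ∀ i, 0 ≤ h i) (n : ℕ) :
    ∃ g : ℕ → ℝ, Antitone g ∧ (∀ i, 0 ≤ g i) ∧ (∀ i, n ≤ i → g i = 0) ∧
      ∑ i ∈ Finset.range n, h i ^ q * V i ≤ ∑ i ∈ Finset.range n, h i * g i * δ ∧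
      ∑ i ∈ Finset.range n, W i * g i ^ r ≤ K ^ r * ∑ i ∈ Finset.range n, h i ^ q * V i := by
  have hq1 : 1 < q := hqr.lt
  have hq0 : 0 < q := hqr.pos
  have hr0 : 0 < r := hqr.symm.pos
  have hrq : (q - 1) * (r / q) = 1 := by
    have := hqr.symm.sub_one_mul_conj
    have := hqr.sub_one_mul_conj
    field_simp
    linarith
  have hqrr : (q - 1) * r = q := hqr.sub_one_mul_conj
  -- The sequence `h^{q-1} V / δ` is the one whose pairing with `h` is exactly `∑ h^q V`; its level
  -- sequence is decreasing and pairs at least as well.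
  obtain ⟨g, ganti, g0, gz, -, gsum, gΦ⟩ := exists_level_sequence n
    (fun i => h i ^ (q - 1) * V i / δ)
    (fun i => div_nonneg (mul_nonneg (Real.rpow_nonneg (h0 i) _) (hV i)) hδ.le)
  refine ⟨g, ganti, g0, gz, ?_, ?_⟩
  · rw [← Finset.sum_mul]
    refine le_trans (le_of_eq ?_)
      (mul_le_mul_of_nonneg_right (sum_mul_le_sum_mul_of_antitone hh h0 gsum) hδ.le)
    rw [Finset.sum_mul]
    refine Finset.sum_congr rfl fun i _ => ?_
    have : h i ^ q = h i * h i ^ (q - 1) := by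
      rcases (h0 i).eq_or_lt with h' | h'
      · rw [← h', Real.zero_rpow hq0.ne', zero_mul]
      · rw [mul_comm, ← Real.rpow_add_one h'.ne', sub_add_cancel]
    rw [this]
    field_simp
  · rw [Finset.mul_sum]
    refine gΦ (fun i x => W i * x ^ r) _ fun a k hk _ => ?_
    have hkδ : 0 < k * δ := mul_pos (by exact_mod_cast hk) hδ
    rw [← Finset.sum_mul, ← Finset.mul_sum]
    set T := ∑ i ∈ Finset.range k, h (a + i) ^ q * V (a + i)
    set Vs := ∑ i ∈ Finset.range k, V (a + i)
    set Ws := ∑ i ∈ Finset.range k, W (a + i)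
    have hT : 0 ≤ T := Finset.sum_nonneg fun i _ => mul_nonneg (Real.rpow_nonneg (h0 _) _) (hV _)
    have hVs : 0 ≤ Vs := Finset.sum_nonneg fun i _ => hV _
    have hWs : 0 ≤ Ws := Finset.sum_nonneg fun i _ => hW _
    -- Hölder on one block, from `h^{q-1} V = (h^q V)^{1/r} V^{1/q}`.
    have hold : ∑ i ∈ Finset.range k, h (a + i) ^ (q - 1) * V (a + i) ≤
        T ^ (1 / r) * Vs ^ (1 / q) := by
      have := Real.inner_le_Lp_mul_Lq_of_nonneg (Finset.range k) hqr.symm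
        (f := fun i => h (a + i) ^ (q - 1) * V (a + i) ^ (1 / r))
        (g := fun i => V (a + i) ^ (1 / q))
        (fun i _ => mul_nonneg (Real.rpow_nonneg (h0 _) _) (Real.rpow_nonneg (hV _) _))
        (fun i _ => Real.rpow_nonneg (hV _) _)
      convert this using 1
      · refine Finset.sum_congr rfl fun i _ => ?_
        rw [mul_assoc, ← Real.rpow_add' (hV _), one_div, one_div, hqr.symm.inv_add_inv_eq_one,
          Real.rpow_one]
        rw [one_div, one_div, hqr.symm.inv_add_inv_eq_one]
        exact one_ne_zero
      · congr 2
        · refine Finset.sum_congr rfl fun i _ => ?_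
          rw [Real.mul_rpow (Real.rpow_nonneg (h0 _) _) (Real.rpow_nonneg (hV _) _),
            ← Real.rpow_mul (h0 _), ← Real.rpow_mul (hV _), hqrr, one_div_mul_cancel hr0.ne',
            Real.rpow_one]
        · refine Finset.sum_congr rfl fun i _ => ?_
          rw [← Real.rpow_mul (hV _), one_div_mul_cancel hq0.ne', Real.rpow_one]
    -- The Muckenhoupt hypothesis raised to the power `r / q = 1 / (q - 1)`.
    have hA' : Ws * Vs ^ (r / q) ≤ K ^ r * (k * δ) ^ r := by
      have := Real.rpow_le_rpow (by positivity) (hA a k hk) (div_nonneg hr0.le hq0.le)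
      rwa [Real.mul_rpow (by positivity) hVs, ← Real.rpow_mul hWs, hrq, Real.rpow_one,
        ← Real.rpow_mul (by positivity), mul_div_cancel₀ _ hq0.ne',
        Real.mul_rpow hK hkδ.le] at this
    have havg : (∑ i ∈ Finset.range k, h (a + i) ^ (q - 1) * V (a + i) / δ) / k =
        (∑ i ∈ Finset.range k, h (a + i) ^ (q - 1) * V (a + i)) / (k * δ) := by
      rw [← Finset.sum_div, div_div, mul_comm δ]
    have hS0 : 0 ≤ ∑ i ∈ Finset.range k, h (a + i) ^ (q - 1) * V (a + i) :=
      Finset.sum_nonneg fun i _ => mul_nonneg (Real.rpow_nonneg (h0 _) _) (hV _)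
    rw [havg, Real.div_rpow hS0 hkδ.le, mul_div_assoc', div_le_iff₀ (by positivity)]
    calc Ws * (∑ i ∈ Finset.range k, h (a + i) ^ (q - 1) * V (a + i)) ^ r
        ≤ Ws * (T ^ (1 / r) * Vs ^ (1 / q)) ^ r := by gcongr
      _ = T * (Ws * Vs ^ (r / q)) := by
        rw [Real.mul_rpow (by positivity) (by positivity), ← Real.rpow_mul hT,
          ← Real.rpow_mul hVs, one_div_mul_cancel hr0.ne', Real.rpow_one, one_div_mul_eq_div]
        ring
      _ ≤ T * (K ^ r * (k * δ) ^ r) := by gcongr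
      _ = _ := by ring

end Sequences

/-! ### Duality against decreasing step functions on the half-line. -/

section HalfLine

open Filter Topology

theorem lintegral_Ioc_ofReal_rpow {A B η : ℝ} (hA : 0 ≤ A) (hAB : A ≤ B) (hη : 0 < η) :
    ∫⁻ t in Ioc A B, ENNReal.ofReal (t ^ (η - 1)) = ENNReal.ofReal ((B ^ η - A ^ η) / η) := by
  have h1 : IntervalIntegrable (fun t : ℝ => t ^ (η - 1)) volume A B :=
    intervalIntegral.intervalIntegrable_rpow' (by linarith)
  have h2 := integral_rpow (a := A) (b := B) (r := η - 1) (Or.inl (by linarith))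
  rw [sub_add_cancel, intervalIntegral.integral_of_le hAB] at h2
  rw [← h2, ofReal_integral_eq_lintegral_ofReal]
  · exact (intervalIntegrable_iff_integrableOn_Ioc_of_le hAB).1 h1
  · filter_upwards [ae_restrict_mem measurableSet_Ioc] with t ht
    exact Real.rpow_nonneg (hA.trans ht.1.le) _

theorem lintegral_Ioc_zero_eq_sum (f : ℝ → ℝ≥0∞) {δ : ℝ} (hδ : 0 ≤ δ) (n : ℕ) :
    ∫⁻ t in Ioc 0 (n * δ), f t =
      ∑ i ∈ Finset.range n, ∫⁻ t in Ioc (i * δ) ((i + 1) * δ), f t := by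
  induction n with
  | zero => simp
  | succ n ih =>
    rw [Finset.sum_range_succ, ← ih, ← lintegral_union measurableSet_Ioc
      (Ioc_disjoint_Ioc_of_le le_rfl), Ioc_union_Ioc_eq_Ioc (by positivity) (by nlinarith)]
    push_cast
    rfl

theorem lorentz_integrand_eq {p q t : ℝ} (hq : 0 ≤ q) (ht : 0 < t) (x : ℝ≥0∞) :
    (ENNReal.ofReal t ^ (1 / p) * x) ^ q * ENNReal.ofReal (1 / t) =
      ENNReal.ofReal (t ^ (q / p - 1)) * x ^ q := by
  rw [ENNReal.mul_rpow_of_nonneg _ _ hq, ENNReal.ofReal_rpow_of_pos ht,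
    ENNReal.ofReal_rpow_of_pos (Real.rpow_pos_of_pos ht _), mul_right_comm,
    ← ENNReal.ofReal_mul (by positivity), ← Real.rpow_mul ht.le, Real.rpow_sub_one ht.ne']
  rw [one_div_mul_eq_div p q, mul_one_div]

theorem lorentzNorm_eq {R : Type*} [MeasurableSpace R] (f : R → ℝ≥0∞) (p : ℝ) {s : ℝ≥0∞}
    (hs : s ≠ ∞) (μ : Measure R) :
    lorentzNorm f p s μ = (∫⁻ t in Ioi (0 : ℝ),
      ENNReal.ofReal (t ^ (s.toReal / p - 1)) * rearrangement f μ t ^ s.toReal)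
        ^ (1 / s.toReal) := by
  rw [lorentzNorm, if_neg hs]
  congr 1
  exact setLIntegral_congr_fun measurableSet_Ioi fun t ht =>
    lorentz_integrand_eq ENNReal.toReal_nonneg ht _

/-- Summation by parts in `[0, ∞]`. -/
theorem sum_ofReal_mul_eq {g : ℕ → ℝ} (hg : Antitone g) (h0 : ∀ i, 0 ≤ g i) (x : ℕ → ℝ≥0∞)
    (n : ℕ) :
    ∑ i ∈ Finset.range n, ENNReal.ofReal (g i) * x i =
      ∑ k ∈ Finset.range n, ENNReal.ofReal (g k - g (k + 1)) * ∑ i ∈ Finset.range (k + 1), x i +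
        ENNReal.ofReal (g n) * ∑ i ∈ Finset.range n, x i := by
  induction n with
  | zero => simp
  | succ n ih =>
    rw [Finset.sum_range_succ, ih,
      Finset.sum_range_succ (fun k => ENNReal.ofReal (g k - g (k + 1)) *
        ∑ i ∈ Finset.range (k + 1), x i), add_assoc, add_assoc, ← add_mul,
      ← ENNReal.ofReal_add (sub_nonneg.2 (hg (Nat.le_succ n))) (h0 _), sub_add_cancel,
      Finset.sum_range_succ x n, mul_add]

variable {p q r : ℝ}

/-- Hölder's inequality between the weighted `L^q` norm and a step function. -/
theorem sum_ofReal_mul_lintegral_le (hqr : q.HolderConjugate r) {θ : ℝ}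
    (hθ0 : 0 < θ) (hθ : θ = r * (1 - 1 / p)) {h : ℝ → ℝ≥0∞} (hh : Measurable h) {δ : ℝ}
    (hδ : 0 < δ) {g : ℕ → ℝ} (h0 : ∀ i, 0 ≤ g i) (n : ℕ) :
    ∑ i ∈ Finset.range n, ENNReal.ofReal (g i) * ∫⁻ t in Ioc (i * δ) ((i + 1) * δ), h t ≤
      (∫⁻ t in Ioi (0 : ℝ), ENNReal.ofReal (t ^ (q / p - 1)) * h t ^ q) ^ (1 / q) *
      (ENNReal.ofReal (∑ i ∈ Finset.range n,
        (((i + 1) * δ) ^ θ - (i * δ) ^ θ) / θ * g i ^ r)) ^ (1 / r) := by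
  have hq0 : 0 < q := hqr.pos
  have hr0 : 0 < r := hqr.symm.pos
  have hW : ∀ i : ℕ, 0 ≤ (((i + 1) * δ) ^ θ - (i * δ) ^ θ) / θ := fun i =>
    div_nonneg (sub_nonneg.2 (Real.rpow_le_rpow (by positivity) (by nlinarith) hθ0.le)) hθ0.le
  have step : ∀ i : ℕ, ∫⁻ t in Ioc (i * δ) ((i + 1) * δ), h t ≤
      (∫⁻ t in Ioc (i * δ) ((i + 1) * δ), ENNReal.ofReal (t ^ (q / p - 1)) * h t ^ q) ^ (1 / q) *
        ENNReal.ofReal ((((i + 1) * δ) ^ θ - (i * δ) ^ θ) / θ) ^ (1 / r) := by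
    intro i
    -- On a cell, `h` is split as `(t^{1/p-1/q} h) · t^{1/q-1/p}`; the `r`-th power of the second
    -- factor is `t^{θ-1}`. A discrete Hölder inequality then combines the cells.
    have hold := ENNReal.lintegral_mul_le_Lp_mul_Lq
      (volume.restrict (Ioc (i * δ) ((i + 1) * δ))) hqr
      (f := fun t => ENNReal.ofReal (t ^ (1 / p - 1 / q)) * h t)
      (g := fun t => ENNReal.ofReal (t ^ (1 / q - 1 / p)))
      (by fun_prop) (by fun_prop)
    have hpos : ∀ t ∈ Ioc (i * δ) ((i + 1) * δ), 0 < t := fun t ht =>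
      lt_of_le_of_lt (by positivity) ht.1
    refine le_trans (le_of_eq ?_) (hold.trans (le_of_eq ?_))
    · refine setLIntegral_congr_fun measurableSet_Ioc fun t ht => ?_
      have ht0 := hpos t ht
      simp only [Pi.mul_apply]
      rw [mul_right_comm, ← ENNReal.ofReal_mul (by positivity), ← Real.rpow_add ht0]
      simp
    · congr 2
      · refine setLIntegral_congr_fun measurableSet_Ioc fun t ht => ?_
        have ht0 := hpos t ht
        rw [ENNReal.mul_rpow_of_nonneg _ _ hq0.le,
          ENNReal.ofReal_rpow_of_pos (Real.rpow_pos_of_pos ht0 _), ← Real.rpow_mul ht0.le]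
        congr 3
        field_simp
      · rw [← lintegral_Ioc_ofReal_rpow (by positivity) (by nlinarith) hθ0]
        refine setLIntegral_congr_fun measurableSet_Ioc fun t ht => ?_
        have ht0 := hpos t ht
        rw [ENNReal.ofReal_rpow_of_pos (Real.rpow_pos_of_pos ht0 _), ← Real.rpow_mul ht0.le]
        congr 2
        have h1 := hqr.inv_add_inv_eq_one
        have h2 : r * (1 / q) = r - 1 := by
          rw [one_div, eq_sub_of_add_eq h1]
          field_simp
        rw [hθ, sub_mul, mul_comm, h2]
        ring
  calc ∑ i ∈ Finset.range n, ENNReal.ofReal (g i) * ∫⁻ t in Ioc (i * δ) ((i + 1) * δ), h t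
      ≤ ∑ i ∈ Finset.range n, (∫⁻ t in Ioc (i * δ) ((i + 1) * δ),
          ENNReal.ofReal (t ^ (q / p - 1)) * h t ^ q) ^ (1 / q) * (ENNReal.ofReal (g i) *
            ENNReal.ofReal ((((i + 1) * δ) ^ θ - (i * δ) ^ θ) / θ) ^ (1 / r)) := by
        refine Finset.sum_le_sum fun i _ => ?_
        rw [mul_left_comm]
        gcongr
        exact step i
    _ ≤ _ := ENNReal.inner_le_Lp_mul_Lq _ _ _ hqr
    _ ≤ _ := by
        gcongr ?_ ^ _ * ?_ ^ _
        · simp only [← ENNReal.rpow_mul, one_div_mul_cancel hq0.ne', ENNReal.rpow_one]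
          rw [← lintegral_Ioc_zero_eq_sum _ hδ.le]
          exact lintegral_mono_set Ioc_subset_Ioi_self
        · rw [ENNReal.ofReal_sum_of_nonneg
            fun i _ => mul_nonneg (hW i) (Real.rpow_nonneg (h0 i) _)]
          refine Finset.sum_le_sum fun i _ => le_of_eq ?_
          rw [ENNReal.mul_rpow_of_nonneg _ _ hr0.le, ← ENNReal.rpow_mul,
            one_div_mul_cancel hr0.ne', ENNReal.rpow_one,
            ENNReal.ofReal_rpow_of_nonneg (h0 i) hr0.le, mul_comm, ENNReal.ofReal_mul (hW i)]

/-- If a decreasing function pairs with all decreasing step functions as a functional of norm at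
most `D`, then its weighted `L^q` norm on a grid is at most `c D`. -/
theorem sum_rpow_le_of_pairing (hp : 1 < p) (hqr : q.HolderConjugate r) {θ η c : ℝ}
    (hθ0 : 0 < θ) (hθ : θ = r * (1 - 1 / p)) (hη : η = q / p)
    (hc : c = (1 / η) ^ (1 / q) * (1 / θ) ^ (1 / r))
    {h : ℝ → ℝ≥0∞} (hh : Antitone h) (hfin : ∀ t, 0 < t → h t ≠ ∞) {D : ℝ≥0∞} {δ : ℝ} (hδ : 0 < δ)
    (n : ℕ) (H : ∀ g : ℕ → ℝ, Antitone g → (∀ i, 0 ≤ g i) → g n = 0 →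
      ∑ i ∈ Finset.range n, ENNReal.ofReal (g i) * ∫⁻ t in Ioc (i * δ) ((i + 1) * δ), h t ≤
        D * (ENNReal.ofReal (∑ i ∈ Finset.range n,
          (((i + 1) * δ) ^ θ - (i * δ) ^ θ) / θ * g i ^ r)) ^ (1 / r)) :
    ∑ i ∈ Finset.range n, ENNReal.ofReal ((((i + 1) * δ) ^ η - (i * δ) ^ η) / η) *
      h ((i + 1) * δ) ^ q ≤ (ENNReal.ofReal c * D) ^ q := by
  have hq0 : 0 < q := hqr.pos
  have hr0 : 0 < r := hqr.symm.pos
  have hη0 : 0 < η := by rw [hη]; positivity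
  have hc0 : 0 ≤ c := by rw [hc]; positivity
  have hqr1 : q / r = q - 1 := by
    have := hqr.sub_one_mul_conj
    rw [div_eq_iff hr0.ne', this]
  set V : ℕ → ℝ := fun i => (((i + 1) * δ) ^ η - (i * δ) ^ η) / η with hVdef
  set W : ℕ → ℝ := fun i => (((i + 1) * δ) ^ θ - (i * δ) ^ θ) / θ with hWdef
  have hV : ∀ i, 0 ≤ V i := fun i =>
    div_nonneg (sub_nonneg.2 (Real.rpow_le_rpow (by positivity) (by nlinarith) hη0.le)) hη0.le
  have hW : ∀ i, 0 ≤ W i := fun i =>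
    div_nonneg (sub_nonneg.2 (Real.rpow_le_rpow (by positivity) (by nlinarith) hθ0.le)) hθ0.le
  -- The cell weights are integrals of `t^{ζ-1}`, so sums over consecutive cells telescope and the
  -- Muckenhoupt condition becomes the one for an interval.
  have hsum : ∀ (ζ : ℝ) (a k : ℕ), ∑ i ∈ Finset.range k,
      (((((a + i : ℕ) : ℝ) + 1) * δ) ^ ζ - ((a + i : ℕ) * δ) ^ ζ) / ζ =
        (((a + k) * δ) ^ ζ - (a * δ) ^ ζ) / ζ := by
    intro ζ a k
    rw [← Finset.sum_div]
    have := Finset.sum_range_sub (fun i : ℕ => ((a + i) * δ) ^ ζ) k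
    simp only [Nat.cast_zero, add_zero] at this
    rw [← this]
    push_cast
    simp only [add_assoc]
  have hcq : c ^ q = 1 / η * (1 / θ) ^ (q - 1) := by
    rw [hc, Real.mul_rpow (by positivity) (by positivity), ← Real.rpow_mul (by positivity),
      ← Real.rpow_mul (by positivity), one_div_mul_cancel hq0.ne', Real.rpow_one,
      one_div_mul_eq_div r q, hqr1]
  have hA : ∀ a k, 0 < k → (∑ i ∈ Finset.range k, W (a + i)) ^ (q - 1) *
      ∑ i ∈ Finset.range k, V (a + i) ≤ (c * (k * δ)) ^ q := by
    intro a k _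
    simp only [hWdef, hVdef, hsum]
    have hθη : (q - 1) * θ + η = q := by
      rw [hθ, hη, ← mul_assoc, hqr.sub_one_mul_conj]
      ring
    have hAB : (a : ℝ) * δ ≤ (a + k) * δ := by gcongr; simp
    have main := rpow_sub_rpow_mul_le (A := a * δ) (B := (a + k) * δ) (by positivity) hAB
      hθ0 hη0 hqr.lt hθη
    have hX : 0 ≤ ((a + k) * δ) ^ θ - (a * δ) ^ θ :=
      sub_nonneg.2 (Real.rpow_le_rpow (by positivity) hAB hθ0.le)
    rw [Real.mul_rpow hc0 (by positivity), hcq, div_eq_mul_one_div _ θ,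
      Real.mul_rpow hX (by positivity), div_eq_mul_one_div _ η]
    have e : (k : ℝ) * δ = (a + k) * δ - a * δ := by ring
    rw [e]
    calc _ = 1 / η * (1 / θ) ^ (q - 1) * ((((a + k) * δ) ^ θ - (a * δ) ^ θ) ^ (q - 1) *
          (((a + k) * δ) ^ η - (a * δ) ^ η)) := by ring
      _ ≤ _ := by gcongr
  -- Sampling at right endpoints bounds `h` from below on each cell and avoids `t = 0`, where `h`
  -- may be infinite.
  obtain ⟨g, ganti, g0, gz, hg1, hg2⟩ := exists_antitone_pairing hqr hδ hc0 hV hW hA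
    (h := fun i : ℕ => (h ((i + 1) * δ)).toReal)
    (fun i j hij => ENNReal.toReal_mono (hfin _ (by positivity)) (hh (by gcongr)))
    (fun i => ENNReal.toReal_nonneg) n
  set T := ∑ i ∈ Finset.range n, (h ((i + 1) * δ)).toReal ^ q * V i with hT
  have hT0 : 0 ≤ T :=
    Finset.sum_nonneg fun i _ => mul_nonneg (Real.rpow_nonneg ENNReal.toReal_nonneg _) (hV i)
  have hTeq : ∑ i ∈ Finset.range n, ENNReal.ofReal (V i) * h ((i + 1) * δ) ^ q =
      ENNReal.ofReal T := by
    rw [hT, ENNReal.ofReal_sum_of_nonneg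
      fun i _ => mul_nonneg (Real.rpow_nonneg ENNReal.toReal_nonneg _) (hV i)]
    refine Finset.sum_congr rfl fun i _ => ?_
    rw [mul_comm, ENNReal.ofReal_mul (Real.rpow_nonneg ENNReal.toReal_nonneg _),
      ← ENNReal.ofReal_rpow_of_nonneg ENNReal.toReal_nonneg hq0.le,
      ENNReal.ofReal_toReal (hfin _ (by positivity))]
  rw [hTeq]
  -- As `T` is finite, a factor `T^{1/r}` can be cancelled, leaving `T^{1/q} ≤ c D`.
  have key : ENNReal.ofReal T ≤ ENNReal.ofReal c * D * ENNReal.ofReal T ^ (1 / r) := by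
    calc ENNReal.ofReal T
        ≤ ENNReal.ofReal (∑ i ∈ Finset.range n, (h ((i + 1) * δ)).toReal * g i * δ) :=
          ENNReal.ofReal_le_ofReal hg1
      _ = ∑ i ∈ Finset.range n, ENNReal.ofReal (g i) * (h ((i + 1) * δ) * ENNReal.ofReal δ) := by
          rw [ENNReal.ofReal_sum_of_nonneg
            fun i _ => mul_nonneg (mul_nonneg ENNReal.toReal_nonneg (g0 i)) hδ.le]
          refine Finset.sum_congr rfl fun i _ => ?_
          rw [ENNReal.ofReal_mul (mul_nonneg ENNReal.toReal_nonneg (g0 i)),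
            ENNReal.ofReal_mul ENNReal.toReal_nonneg,
            ENNReal.ofReal_toReal (hfin _ (by positivity))]
          ring
      _ ≤ ∑ i ∈ Finset.range n, ENNReal.ofReal (g i) *
            ∫⁻ t in Ioc (i * δ) ((i + 1) * δ), h t := by
          gcongr with i _
          have : h ((i + 1) * δ) * ENNReal.ofReal δ =
              ∫⁻ _ in Ioc (i * δ) ((i + 1) * δ), h ((i + 1) * δ) := by
            rw [setLIntegral_const, Real.volume_Ioc]
            congr 2
            ring
          rw [this]
          exact setLIntegral_mono' measurableSet_Ioc fun t ht => hh ht.2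
      _ ≤ D * (ENNReal.ofReal (∑ i ∈ Finset.range n, W i * g i ^ r)) ^ (1 / r) :=
          H g ganti g0 (gz n le_rfl)
      _ ≤ D * (ENNReal.ofReal (c ^ r * T)) ^ (1 / r) := by gcongr
      _ = _ := by
          rw [ENNReal.ofReal_mul (by positivity), ENNReal.mul_rpow_of_nonneg _ _ (by positivity),
            ENNReal.ofReal_rpow_of_nonneg (by positivity) (by positivity), ← Real.rpow_mul hc0,
            mul_one_div_cancel hr0.ne', Real.rpow_one]
          ring
  rcases eq_or_ne (ENNReal.ofReal T) 0 with hz | hz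
  · rw [hz]
    exact zero_le
  have h1 : ENNReal.ofReal T = ENNReal.ofReal T ^ (1 / q) * ENNReal.ofReal T ^ (1 / r) := by
    rw [← ENNReal.rpow_add _ _ hz ENNReal.ofReal_ne_top, one_div, one_div,
      hqr.inv_add_inv_eq_one, ENNReal.rpow_one]
  conv_lhs at key => rw [h1]
  have h2 := (ENNReal.mul_le_mul_iff_left (ENNReal.rpow_pos (pos_iff_ne_zero.2 hz)
    ENNReal.ofReal_ne_top).ne' (ENNReal.rpow_ne_top_of_nonneg (by positivity)
      ENNReal.ofReal_ne_top)).1 key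
  have h3 := ENNReal.rpow_le_rpow h2 hq0.le
  rwa [← ENNReal.rpow_mul, one_div_mul_cancel hq0.ne', ENNReal.rpow_one] at h3

/-- A decreasing function which pairs with all decreasing step functions as a functional of norm
at most `D` has weighted `L^q` norm at most `c D`. -/
theorem lintegral_rpow_le_of_pairing (hp : 1 < p) (hqr : q.HolderConjugate r) {θ η c : ℝ}
    (hθ0 : 0 < θ) (hθ : θ = r * (1 - 1 / p)) (hη : η = q / p)
    (hc : c = (1 / η) ^ (1 / q) * (1 / θ) ^ (1 / r))
    {h : ℝ → ℝ≥0∞} (hh : Antitone h) {D : ℝ≥0∞}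
    (H : ∀ (δ : ℝ) (n : ℕ) (g : ℕ → ℝ), 0 < δ → Antitone g → (∀ i, 0 ≤ g i) → g n = 0 →
      ∑ i ∈ Finset.range n, ENNReal.ofReal (g i) * ∫⁻ t in Ioc (i * δ) ((i + 1) * δ), h t ≤
        D * (ENNReal.ofReal (∑ i ∈ Finset.range n,
          (((i + 1) * δ) ^ θ - (i * δ) ^ θ) / θ * g i ^ r)) ^ (1 / r)) :
    ∫⁻ t in Ioi (0 : ℝ), ENNReal.ofReal (t ^ (q / p - 1)) * h t ^ q ≤
      (ENNReal.ofReal c * D) ^ q := by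
  have hq0 : 0 < q := hqr.pos
  have hr0 : 0 < r := hqr.symm.pos
  have hη0 : 0 < η := by rw [hη]; positivity
  have hc0 : 0 < c := by rw [hc]; positivity
  rcases eq_or_ne D ∞ with rfl | hD
  · rw [ENNReal.mul_top (ENNReal.ofReal_pos.2 hc0).ne', ENNReal.top_rpow_of_pos hq0]
    exact le_top
  -- Testing with a single step on `(0, t]` shows that `∫₀ᵗ h` is finite.
  have hfin : ∀ t, 0 < t → h t ≠ ∞ := by
    intro t ht
    have h1 := H t 1 (fun i => if i = 0 then 1 else 0) ht
      (by
        intro i j hij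
        rcases Nat.eq_zero_or_pos j with rfl | hj
        · rw [Nat.le_zero.1 hij]
        · simp only [if_neg hj.ne']
          split_ifs <;> norm_num)
      (by intro i; split_ifs <;> norm_num) (by simp)
    have h2 : h t * ENNReal.ofReal t ≤ ∫⁻ x in Ioc 0 t, h x := by
      have : h t * ENNReal.ofReal t = ∫⁻ _ in Ioc 0 t, h t := by simp
      rw [this]
      exact setLIntegral_mono' measurableSet_Ioc fun x hx => hh hx.2
    have h3 : ∫⁻ x in Ioc 0 t, h x < ∞ := by
      simp only [Finset.range_one, Finset.sum_singleton, if_pos, Nat.cast_zero, zero_mul,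
        zero_add, one_mul, ENNReal.ofReal_one] at h1
      exact h1.trans_lt (ENNReal.mul_lt_top hD.lt_top
        (ENNReal.rpow_lt_top_of_nonneg (by positivity) ENNReal.ofReal_ne_top))
    intro htop
    rw [htop, ENNReal.top_mul (ENNReal.ofReal_pos.2 ht).ne'] at h2
    exact absurd h3 (not_lt.2 h2)
  -- The integrand on `(0, n + 1]` with `h` sampled at right endpoints of a grid of mesh `1 / (n +
  -- 1)`, hence `(n + 1)^2` cells.
  set F : ℕ → ℝ → ℝ≥0∞ := fun n => (Ioc (0 : ℝ) (n + 1)).indicator fun t =>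
    ENNReal.ofReal (t ^ (q / p - 1)) * h (⌈t * (n + 1)⌉₊ / (n + 1)) ^ q with hF
  have hFm : ∀ n, Measurable (F n) := by
    intro n
    refine Measurable.indicator ?_ measurableSet_Ioc
    refine Measurable.mul (by fun_prop) ((hh.measurable.comp ?_).pow_const _)
    exact (measurable_from_nat.comp (Nat.measurable_ceil.comp (by fun_prop))).div_const _
  have hFint : ∀ n, ∫⁻ t in Ioi (0 : ℝ), F n t ≤ (ENNReal.ofReal c * D) ^ q := by
    intro n
    have hδ : (0 : ℝ) < 1 / (n + 1) := by positivity
    refine le_trans (le_of_eq ?_) (sum_rpow_le_of_pairing hp hqr hθ0 hθ hη hc hh hfin hδ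
      ((n + 1) ^ 2) (H _ _ · hδ))
    rw [hF]
    simp only
    rw [lintegral_indicator measurableSet_Ioc, Measure.restrict_restrict measurableSet_Ioc,
      inter_eq_left.2 Ioc_subset_Ioi_self]
    have e : ((n : ℝ) + 1) = (((n + 1) ^ 2 : ℕ) : ℝ) * (1 / (n + 1)) := by
      push_cast
      field_simp
    conv_lhs => rw [show Ioc (0 : ℝ) (n + 1) = Ioc 0 ((((n + 1) ^ 2 : ℕ) : ℝ) * (1 / (n + 1))) by
      rw [← e]]
    rw [lintegral_Ioc_zero_eq_sum _ hδ.le]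
    refine Finset.sum_congr rfl fun i _ => ?_
    rw [← lintegral_Ioc_ofReal_rpow (by positivity) (by nlinarith) hη0,
      ← lintegral_mul_const _ (by fun_prop)]
    refine setLIntegral_congr_fun measurableSet_Ioc fun t ht => ?_
    have hceil : ⌈t * (n + 1)⌉₊ = i + 1 := by
      have h1 := ht.1
      have h2 := ht.2
      rw [mul_one_div, div_lt_iff₀ (by positivity)] at h1
      rw [mul_one_div, le_div_iff₀ (by positivity)] at h2
      rw [Nat.ceil_eq_iff (by omega)]
      push_cast
      constructor
      · simpa using h1
      · exact h2
    simp only [hceil, hη]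
    push_cast
    rw [mul_one_div]
  -- A monotone function is continuous off a countable set, so the samples converge almost
  -- everywhere and Fatou's lemma applies.
  have hlim : ∀ᵐ t ∂(volume.restrict (Ioi (0 : ℝ))),
      ENNReal.ofReal (t ^ (q / p - 1)) * h t ^ q = liminf (fun n => F n t) atTop := by
    have hcont : ∀ᵐ t : ℝ, ContinuousAt h t := by
      filter_upwards [hh.countable_not_continuousAt.ae_notMem volume] with t ht
      simpa using ht
    filter_upwards [ae_restrict_mem measurableSet_Ioi, ae_restrict_of_ae hcont] with t ht htc
    have ht0 : (0 : ℝ) < t := ht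
    symm
    apply Tendsto.liminf_eq
    have hn : Tendsto (fun n : ℕ => (n : ℝ) + 1) atTop atTop :=
      tendsto_atTop_add_const_right _ _ tendsto_natCast_atTop_atTop
    have h1 : Tendsto (fun n : ℕ => (⌈t * ((n : ℝ) + 1)⌉₊ : ℝ) / (n + 1)) atTop (𝓝 t) :=
      (tendsto_nat_ceil_mul_div_atTop ht0.le).comp hn
    have h2 : Tendsto (fun n : ℕ => ENNReal.ofReal (t ^ (q / p - 1)) *
        h (⌈t * (n + 1)⌉₊ / (n + 1)) ^ q) atTop
          (𝓝 (ENNReal.ofReal (t ^ (q / p - 1)) * h t ^ q)) :=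
      ENNReal.Tendsto.const_mul ((ENNReal.continuous_rpow_const.tendsto _).comp
        (htc.tendsto.comp h1)) (Or.inr ENNReal.ofReal_ne_top)
    refine h2.congr' ?_
    filter_upwards [hn.eventually_ge_atTop t] with n hnt
    rw [hF]
    simp only
    rw [indicator_of_mem (show t ∈ Ioc (0 : ℝ) (n + 1) from ⟨ht0, hnt⟩)]
  rw [lintegral_congr_ae hlim]
  refine (lintegral_liminf_le hFm).trans ?_
  refine liminf_le_of_frequently_le' (Frequently.of_forall hFint)

end HalfLine

/-! ### The inequality with its constant. -/

section Minkowski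

variable {R Q : Type*} [MeasurableSpace R] {μ : Measure R} [SFinite μ]
  [MeasurableSpace Q] {ν : Measure Q} [SFinite ν]

theorem lorentzNorm_lintegral_le_top {f : R × Q → ℝ≥0∞} (hf : Measurable f) {p : ℝ}
    (hp : 1 < p) :
    lorentzNorm (fun x => ∫⁻ y, f (x, y) ∂ν) p ∞ μ ≤
      ENNReal.ofReal (lorentzConst p ∞) * ∫⁻ y, lorentzNorm (fun x => f (x, y)) p ∞ μ ∂ν := by
  have hp0 : 0 < p := by linarith
  have hmeas := measurable_lorentzNorm_section (μ := μ) hf hp0 ∞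
  rw [lorentzConst, if_pos rfl]
  conv_lhs => rw [lorentzNorm, if_pos rfl]
  refine iSup₂_le fun t ht => ?_
  have ht0 : (0 : ℝ) < t := ht
  set N := ∫⁻ y, lorentzNorm (fun x => f (x, y)) p ∞ μ ∂ν with hN
  set F := rearrangement (fun x => ∫⁻ y, f (x, y) ∂ν) μ with hF
  have hη : (0 : ℝ) < 1 - 1 / p := by
    rw [sub_pos, div_lt_one hp0]
    exact hp
  have h1 : F t * ENNReal.ofReal t ≤ ∫⁻ u in Ioc 0 t, F u := by
    have : F t * ENNReal.ofReal t = ∫⁻ _ in Ioc 0 t, F t := by simp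
    rw [this]
    exact setLIntegral_mono' measurableSet_Ioc fun u hu => rearrangement_antitone _ hu.2
  have h2 : ∀ y, ∫⁻ u in Ioc 0 t, rearrangement (fun x => f (x, y)) μ u ≤
      lorentzNorm (fun x => f (x, y)) p ∞ μ * ENNReal.ofReal (t ^ (1 - 1 / p) / (1 - 1 / p)) := by
    intro y
    have h := lintegral_Ioc_ofReal_rpow le_rfl ht0.le hη
    rw [Real.zero_rpow hη.ne', sub_zero] at h
    rw [← h, ← lintegral_const_mul _ (by fun_prop)]
    refine setLIntegral_mono' measurableSet_Ioc fun u hu => ?_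
    have hle : ENNReal.ofReal u ^ (1 / p) * rearrangement (fun x => f (x, y)) μ u ≤
        lorentzNorm (fun x => f (x, y)) p ∞ μ := by
      rw [lorentzNorm, if_pos rfl]
      exact le_iSup₂_of_le u hu.1 le_rfl
    rw [ENNReal.ofReal_rpow_of_pos hu.1] at hle
    calc rearrangement (fun x => f (x, y)) μ u
        = ENNReal.ofReal (u ^ (1 / p)) * rearrangement (fun x => f (x, y)) μ u *
            ENNReal.ofReal (u ^ (1 - 1 / p - 1)) := by
          rw [mul_right_comm, ← ENNReal.ofReal_mul (Real.rpow_nonneg hu.1.le _),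
            ← Real.rpow_add hu.1]
          simp
      _ ≤ _ := by gcongr
  have h3 : F t * ENNReal.ofReal t ≤ N * ENNReal.ofReal (t ^ (1 - 1 / p) / (1 - 1 / p)) := by
    refine (h1.trans (lintegral_Ioc_rearrangement_lintegral_le hf ht0)).trans ?_
    rw [hN, ← lintegral_mul_const _ hmeas]
    exact lintegral_mono h2
  calc ENNReal.ofReal t ^ (1 / p) * F t
      = F t * ENNReal.ofReal t * ENNReal.ofReal (t ^ (1 / p - 1)) := by
        rw [mul_assoc, ← ENNReal.ofReal_mul ht0.le, Real.rpow_sub_one ht0.ne',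
          mul_div_cancel₀ _ ht0.ne', ENNReal.ofReal_rpow_of_pos ht0, mul_comm]
    _ ≤ N * ENNReal.ofReal (t ^ (1 - 1 / p) / (1 - 1 / p)) * ENNReal.ofReal (t ^ (1 / p - 1)) := by
        gcongr
    _ = _ := by
        rw [mul_assoc, ← ENNReal.ofReal_mul (by positivity), mul_comm]
        congr 2
        rw [div_mul_eq_mul_div, ← Real.rpow_add ht0]
        have e : 1 - 1 / p + (1 / p - 1) = 0 := by ring
        rw [e, Real.rpow_zero, Real.conjExponent]
        field_simp

theorem lorentzNorm_lintegral_le_of_ne_top {f : R × Q → ℝ≥0∞} (hf : Measurable f) {p : ℝ}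
    (hp : 1 < p) {s : ℝ≥0∞} (hps : ENNReal.ofReal p < s) (hs : s ≠ ∞) :
    lorentzNorm (fun x => ∫⁻ y, f (x, y) ∂ν) p s μ ≤
      ENNReal.ofReal (lorentzConst p s) * ∫⁻ y, lorentzNorm (fun x => f (x, y)) p s μ ∂ν := by
  have hp0 : 0 < p := by linarith
  have hmeas := measurable_lorentzNorm_section (μ := μ) hf hp0 s
  have hr := measurable_rearrangement_section (μ := μ) hf
  have hpq : p < s.toReal := (ENNReal.ofReal_lt_iff_lt_toReal hp0.le hs).1 hps
  have hqr : s.toReal.HolderConjugate s.toReal.conjExponent :=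
    Real.HolderConjugate.conjExponent (hp.trans hpq)
  set q := s.toReal
  set r := q.conjExponent
  have hq0 : 0 < q := hqr.pos
  have hr0 : 0 < r := hqr.symm.pos
  have hη : (0 : ℝ) < 1 - 1 / p := by
    rw [sub_pos, div_lt_one hp0]
    exact hp
  -- With `η = q / p` and `θ = r (1 - 1 / p)` one has `p / s = 1 / η` and `p' / s' = 1 / θ`.
  have hc : lorentzConst p s = (1 / (q / p)) ^ (1 / q) * (1 / (r * (1 - 1 / p))) ^ (1 / r) := by
    rw [lorentzConst, if_neg hs, one_div_div]
    congr 2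
    rw [Real.conjExponent]
    have : p - 1 ≠ 0 := by linarith
    field_simp
    exact div_self hr0.ne'
  have main := lintegral_rpow_le_of_pairing hp hqr (mul_pos hr0 hη) rfl rfl hc
    (rearrangement_antitone (μ := μ) fun x => ∫⁻ y, f (x, y) ∂ν)
    (D := ∫⁻ y, lorentzNorm (fun x => f (x, y)) p s μ ∂ν) ?_
  · rw [lorentzNorm_eq _ _ hs]
    refine (ENNReal.rpow_le_rpow main (by positivity)).trans_eq ?_
    rw [← ENNReal.rpow_mul, mul_one_div_cancel hq0.ne', ENNReal.rpow_one]
  · intro δ n g hδ ganti g0 gn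
    -- As `g n = 0`, the pairing is a nonnegative combination of the functionals `∫₀ᵘ`, to each of
    -- which Minkowski's inequality applies.
    have parts : ∀ h : ℝ → ℝ≥0∞,
        ∑ i ∈ Finset.range n, ENNReal.ofReal (g i) * ∫⁻ t in Ioc (i * δ) ((i + 1) * δ), h t =
        ∑ k ∈ Finset.range n, ENNReal.ofReal (g k - g (k + 1)) *
          ∫⁻ t in Ioc 0 ((k + 1 : ℕ) * δ), h t := by
      intro h
      rw [sum_ofReal_mul_eq ganti g0, gn]
      simp only [lintegral_Ioc_zero_eq_sum _ hδ.le, ENNReal.ofReal_zero, zero_mul, add_zero]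
    have hin : ∀ u : ℝ, Measurable fun y =>
        ∫⁻ t in Ioc 0 u, rearrangement (fun x => f (x, y)) μ t := fun u =>
      hr.lintegral_prod_right'
    rw [parts, ← lintegral_mul_const _ hmeas]
    calc _ ≤ ∑ k ∈ Finset.range n, ENNReal.ofReal (g k - g (k + 1)) *
          ∫⁻ y, (∫⁻ t in Ioc 0 ((k + 1 : ℕ) * δ), rearrangement (fun x => f (x, y)) μ t) ∂ν := by
          gcongr with k _
          exact lintegral_Ioc_rearrangement_lintegral_le hf (by positivity)
      _ = ∫⁻ y, ∑ k ∈ Finset.range n, ENNReal.ofReal (g k - g (k + 1)) *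
          (∫⁻ t in Ioc 0 ((k + 1 : ℕ) * δ), rearrangement (fun x => f (x, y)) μ t) ∂ν := by
          rw [lintegral_finsetSum _ fun k _ => (hin _).const_mul _]
          exact Finset.sum_congr rfl fun k _ => (lintegral_const_mul _ (hin _)).symm
      _ ≤ _ := by
          refine lintegral_mono fun y => ?_
          rw [← parts, lorentzNorm_eq _ _ hs]
          exact sum_ofReal_mul_lintegral_le hqr (mul_pos hr0 hη) rfl
            (measurable_rearrangement _) hδ g0 n

/-- Minkowski's integral inequality for the Lorentz functional, together with the measurability
of both sides. -/
theorem lorentzNorm_lintegral_le {f : R × Q → ℝ≥0∞} (hf : AEMeasurable f (μ.prod ν)) {p : ℝ}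
    (hp : 1 < p) {s : ℝ≥0∞} (hps : ENNReal.ofReal p < s) :
    AEMeasurable (fun x => ∫⁻ y, f (x, y) ∂ν) μ ∧
      AEMeasurable (fun y => lorentzNorm (fun x => f (x, y)) p s μ) ν ∧
      lorentzNorm (fun x => ∫⁻ y, f (x, y) ∂ν) p s μ ≤
        ENNReal.ofReal (lorentzConst p s) * ∫⁻ y, lorentzNorm (fun x => f (x, y)) p s μ ∂ν := by
  obtain ⟨g, hg, hfg⟩ := hf
  have hF : (fun x => ∫⁻ y, f (x, y) ∂ν) =ᵐ[μ] fun x => ∫⁻ y, g (x, y) ∂ν := by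
    filter_upwards [Measure.ae_ae_of_ae_prod hfg] with x hx
    exact lintegral_congr_ae hx
  have hy : (fun y => lorentzNorm (fun x => f (x, y)) p s μ) =ᵐ[ν]
      fun y => lorentzNorm (fun x => g (x, y)) p s μ := by
    have hswap : ∀ᵐ z ∂ν.prod μ, f z.swap = g z.swap :=
      (Measure.measurePreserving_swap (μ := ν) (ν := μ)).quasiMeasurePreserving.ae hfg
    filter_upwards [Measure.ae_ae_of_ae_prod hswap] with y hy
    exact lorentzNorm_congr hy p s
  refine ⟨⟨_, hg.lintegral_prod_right', hF⟩,
    ⟨_, measurable_lorentzNorm_section hg (by linarith) s, hy⟩, ?_⟩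
  rw [lorentzNorm_congr hF, lintegral_congr_ae hy]
  rcases eq_or_ne s ∞ with rfl | hs
  · exact lorentzNorm_lintegral_le_top hg hp
  · exact lorentzNorm_lintegral_le_of_ne_top hg hp hps hs

end Minkowski

/-! ### Sets of prescribed measure in a nonatomic space. -/

section Nonatomic

variable {R : Type*} [MeasurableSpace R] {μ : Measure R}

theorem IsNonatomic.exists_subset_measure_le_half (hμ : IsNonatomic μ) {A : Set R}
    (hA : MeasurableSet A) (hA0 : 0 < μ A) :
    ∃ B ⊆ A, MeasurableSet B ∧ 0 < μ B ∧ μ B ≤ μ A / 2 := by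
  obtain ⟨B, hBA, hB, hB0, hlt⟩ := hμ A hA hA0
  have hsplit : μ B + μ (A \ B) = μ A := by
    simpa [inter_eq_right.2 hBA] using measure_inter_add_sdiff (μ := μ) A hB
  have h2 : μ A / 2 + μ A / 2 = μ A := ENNReal.add_halves _
  rcases le_total (μ B) (μ A / 2) with h | h
  · exact ⟨B, hBA, hB, hB0, h⟩
  · refine ⟨A \ B, sdiff_subset, hA.diff hB, ?_, ?_⟩
    · rw [pos_iff_ne_zero]
      intro h0
      rw [h0, add_zero] at hsplit
      exact hlt.ne hsplit
    · by_contra! h'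
      have hne : μ A / 2 ≠ ∞ := (h.trans_lt (hlt.trans_le le_top)).ne
      have := ENNReal.add_lt_add_of_le_of_lt hne h h'
      rw [h2, hsplit] at this
      exact lt_irrefl _ this

theorem IsNonatomic.exists_subset_measure_lt (hμ : IsNonatomic μ) {A : Set R}
    (hA : MeasurableSet A) (hA0 : 0 < μ A) (hfin : μ A ≠ ∞) {ε : ℝ≥0∞} (hε : 0 < ε) :
    ∃ B ⊆ A, MeasurableSet B ∧ 0 < μ B ∧ μ B ≤ ε := by
  have iter : ∀ n : ℕ, ∃ B ⊆ A, MeasurableSet B ∧ 0 < μ B ∧ μ B ≤ μ A * 2⁻¹ ^ n := by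
    intro n
    induction n with
    | zero => exact ⟨A, Subset.rfl, hA, hA0, by simp⟩
    | succ n ih =>
      obtain ⟨B, hBA, hB, hB0, hle⟩ := ih
      obtain ⟨C, hCB, hC, hC0, hCle⟩ := hμ.exists_subset_measure_le_half hB hB0
      refine ⟨C, hCB.trans hBA, hC, hC0, hCle.trans ?_⟩
      rw [pow_succ, ← mul_assoc, ENNReal.div_eq_inv_mul, mul_comm]
      gcongr
  obtain ⟨n, hn⟩ := ENNReal.exists_inv_two_pow_lt (ENNReal.div_pos hε.ne' hfin).ne'
  obtain ⟨B, hBA, hB, hB0, hle⟩ := iter n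
  refine ⟨B, hBA, hB, hB0, hle.trans ?_⟩
  rw [mul_comm]
  exact (ENNReal.le_div_iff_mul_le (Or.inl hA0.ne') (Or.inl hfin)).1 hn.le

/-- Sierpiński's theorem: a nonatomic measure takes all intermediate values. -/
theorem IsNonatomic.exists_subset_measure_eq (hμ : IsNonatomic μ) {E : Set R}
    (hE : MeasurableSet E) (hfin : μ E ≠ ∞) {c : ℝ≥0∞} (hc : c ≤ μ E) :
    ∃ B ⊆ E, MeasurableSet B ∧ μ B = c := by
  have hc' : c ≠ ∞ := (hc.trans_lt hfin.lt_top).ne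
  let P : Set R → Prop := fun A => A ⊆ E ∧ MeasurableSet A ∧ μ A ≤ c
  -- Greedy step: `A'` realises at least half of the largest increase of measure available to
  -- admissible supersets of `A`.
  have next : ∀ A : {A // P A}, ∃ A' : {A // P A}, A.1 ⊆ A'.1 ∧
      ∀ B, P B → A.1 ⊆ B → μ B + μ A.1 ≤ μ A'.1 * 2 := by
    intro A
    set S : Set ℝ≥0∞ := {x | ∃ B, P B ∧ A.1 ⊆ B ∧ μ B = x} with hS
    have hSc : sSup S ≤ c := by
      refine sSup_le ?_
      rintro _ ⟨B, hB, -, rfl⟩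
      exact hB.2.2
    have hle : ∀ B, P B → A.1 ⊆ B → μ B ≤ sSup S := fun B hB hAB => le_sSup ⟨B, hB, hAB, rfl⟩
    rcases le_or_gt (sSup S) (μ A.1) with h | h
    · refine ⟨A, Subset.rfl, fun B hB hAB => ?_⟩
      rw [mul_two]
      exact add_le_add_left ((hle B hB hAB).trans h) _
    · have hlt : (sSup S + μ A.1) / 2 < sSup S := by
        refine ENNReal.div_lt_of_lt_mul ?_
        rw [mul_two]
        exact ENNReal.add_lt_add_left (hSc.trans_lt hc'.lt_top).ne h
      obtain ⟨_, ⟨B', hB', hAB', rfl⟩, hgt⟩ := lt_sSup_iff.1 hlt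
      refine ⟨⟨B', hB'⟩, hAB', fun B hB hAB => ?_⟩
      refine le_trans (add_le_add_left (hle B hB hAB) _) ?_
      exact (ENNReal.div_le_iff_le_mul (Or.inl (by simp)) (Or.inl (by simp))).1 hgt.le
  choose nxt hsub hnxt using next
  let A : ℕ → {A // P A} := fun n => Nat.rec ⟨∅, empty_subset _, MeasurableSet.empty, by simp⟩
    (fun _ a => nxt a) n
  have hmono : Monotone fun n => (A n).1 := monotone_nat_of_le_succ fun n => hsub (A n)
  have hU : μ (⋃ n, (A n).1) = ⨆ n, μ (A n).1 := hmono.measure_iUnion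
  have hPU : P (⋃ n, (A n).1) := by
    refine ⟨iUnion_subset fun n => (A n).2.1, MeasurableSet.iUnion fun n => (A n).2.2.1, ?_⟩
    rw [hU]
    exact iSup_le fun n => (A n).2.2.2
  refine ⟨_, hPU.1, hPU.2.1, hPU.2.2.antisymm ?_⟩
  by_contra! hlt
  set U := ⋃ n, (A n).1
  have hUfin : μ U ≠ ∞ := (hlt.trans_le le_top).ne
  have hdiff : 0 < μ (E \ U) := by
    rw [measure_sdiff hPU.1 hPU.2.1.nullMeasurableSet hUfin]
    exact tsub_pos_of_lt (hlt.trans_le hc)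
  obtain ⟨C, hC, hCm, hC0, hCle⟩ := hμ.exists_subset_measure_lt (hE.diff hPU.2.1) hdiff
    ((measure_mono sdiff_subset).trans_lt hfin.lt_top).ne (tsub_pos_of_lt hlt)
  have hdisj : Disjoint U C := disjoint_sdiff_right.mono_right hC
  have hUC : μ (U ∪ C) = μ U + μ C := measure_union hdisj hCm
  have hP : P (U ∪ C) := by
    refine ⟨union_subset hPU.1 (hC.trans sdiff_subset), hPU.2.1.union hCm, ?_⟩
    rw [hUC]
    calc μ U + μ C ≤ μ U + (c - μ U) := by gcongr
      _ = c := add_tsub_cancel_of_le hlt.le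
  -- The set `U ∪ C` was a competitor at every stage; in the limit this forces `μ C = 0`.
  have hbound : μ (U ∪ C) + μ U ≤ μ U * 2 := by
    conv_lhs => rw [hU, ENNReal.add_iSup]
    refine iSup_le fun n => ?_
    refine (hnxt (A n) _ hP ((subset_iUnion (fun n => (A n).1) n).trans subset_union_left)).trans ?_
    gcongr
    exact subset_iUnion (fun n => (A n).1) (n + 1)
  rw [mul_two, hUC] at hbound
  have h1 := (ENNReal.add_le_add_iff_right hUfin).1 hbound
  exact absurd (ENNReal.lt_add_right hUfin hC0.ne') (not_lt.2 h1)

theorem IsNonatomic.exists_disjoint_pieces (hμ : IsNonatomic μ) {δ : ℝ≥0∞} (hδ : δ ≠ ∞) (n : ℕ) :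
    ∀ E : Set R, MeasurableSet E → μ E = n * δ →
      ∃ A : ℕ → Set R, (∀ i, MeasurableSet (A i)) ∧ (∀ i, A i ⊆ E) ∧
        (∀ i j, i ≠ j → Disjoint (A i) (A j)) ∧ ∀ i < n, μ (A i) = δ := by
  induction n with
  | zero =>
    exact fun E _ _ => ⟨fun _ => ∅, by simp⟩
  | succ n ih =>
    intro E hE hμE
    have hfin : μ E ≠ ∞ := by
      rw [hμE]
      exact ENNReal.mul_ne_top (ENNReal.natCast_ne_top _) hδ
    obtain ⟨B, hBE, hB, hμB⟩ := hμ.exists_subset_measure_eq hE hfin (c := δ) (by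
      rw [hμE]
      push_cast
      rw [add_mul, one_mul]
      exact le_add_self)
    obtain ⟨A, hAm, hAE, hAd, hAμ⟩ := ih (E \ B) (hE.diff hB) (by
      rw [measure_sdiff hBE hB.nullMeasurableSet (by rwa [hμB]), hμE, hμB]
      push_cast
      rw [add_mul, one_mul, ENNReal.add_sub_cancel_right hδ])
    refine ⟨fun i => Nat.casesOn i B A, ?_, ?_, ?_, ?_⟩
    · rintro (_ | i)
      exacts [hB, hAm i]
    · rintro (_ | i)
      exacts [hBE, (hAE i).trans sdiff_subset]
    · rintro (_ | i) (_ | j) hij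
      · exact absurd rfl hij
      · exact disjoint_sdiff_right.mono_right (hAE j)
      · exact (disjoint_sdiff_right.mono_right (hAE i)).symm
      · exact hAd i j fun h => hij (by rw [h])
    · rintro (_ | i) hi
      exacts [hμB, hAμ i (by omega)]

end Nonatomic

/-! ### Optimality of the constant. -/

section Optimality

variable {R : Type*} [MeasurableSpace R] {μ : Measure R}

/-- Sum-integral comparison for a decreasing power; each increment is Bernoulli's inequality for `(1
+ 1/(n+1))^θ`. -/
theorem rpow_sub_one_div_le_sum {θ : ℝ} (hθ : 0 < θ) (hθ1 : θ < 1) (n : ℕ) :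
    (((n : ℝ) + 1) ^ θ - 1) / θ ≤ ∑ j ∈ Finset.range n, ((j : ℝ) + 1) ^ (θ - 1) := by
  induction n with
  | zero => simp
  | succ n ih =>
    rw [Finset.sum_range_succ]
    have hn : (0 : ℝ) < n + 1 := by positivity
    have h1 := rpow_one_add_le_one_add_mul_self (s := 1 / ((n : ℝ) + 1)) (p := θ)
      (by linarith [show (0 : ℝ) < 1 / (n + 1) by positivity]) hθ.le hθ1.le
    have h2 := mul_le_mul_of_nonneg_left h1 (Real.rpow_nonneg hn.le θ)
    rw [← Real.mul_rpow hn.le (by positivity), mul_add, mul_one_div_cancel hn.ne', mul_one] at h2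
    have h3 : ((n : ℝ) + 1) ^ θ * (1 + θ * (1 / (n + 1))) =
        (n + 1) ^ θ + θ * (n + 1) ^ (θ - 1) := by
      rw [Real.rpow_sub_one hn.ne']
      ring
    rw [h3] at h2
    rw [div_le_iff₀ hθ] at ih ⊢
    push_cast
    linarith

theorem mul_one_sub_rpow_div_le_sum {θ : ℝ} (hθ : 0 < θ) (hθ1 : θ < 1) {n : ℕ} (hn : 0 < n) :
    n * (1 - (n : ℝ) ^ (-θ)) / θ ≤ ∑ j ∈ Finset.range n, (((j : ℝ) + 1) / n) ^ (θ - 1) := by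
  have hn0 : (0 : ℝ) < n := by exact_mod_cast hn
  have h1 : (((n : ℝ)) ^ θ - 1) / θ ≤ ∑ j ∈ Finset.range n, ((j : ℝ) + 1) ^ (θ - 1) := by
    refine le_trans ?_ (rpow_sub_one_div_le_sum hθ hθ1 n)
    gcongr
    linarith
  have h2 : ∑ j ∈ Finset.range n, (((j : ℝ) + 1) / n) ^ (θ - 1) =
      (n : ℝ) ^ (1 - θ) * ∑ j ∈ Finset.range n, ((j : ℝ) + 1) ^ (θ - 1) := by
    rw [Finset.mul_sum]
    refine Finset.sum_congr rfl fun j _ => ?_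
    rw [Real.div_rpow (by positivity) hn0.le, div_eq_mul_inv, ← Real.rpow_neg hn0.le, neg_sub,
      mul_comm]
  have h3 : n * (1 - (n : ℝ) ^ (-θ)) / θ = (n : ℝ) ^ (1 - θ) * (((n : ℝ) ^ θ - 1) / θ) := by
    rw [mul_div_assoc', mul_sub, mul_sub, ← Real.rpow_add hn0, sub_add_cancel, Real.rpow_one,
      mul_one, mul_one, sub_eq_add_neg 1 θ, Real.rpow_add hn0, Real.rpow_one]
  rw [h2, h3]
  gcongr

/-- Norm bounds for functions with rearrangement below a truncated power, respectively above a
constant on `(0, m)`, whose ratio is the Lorentz constant. -/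
theorem exists_lorentzNorm_bounds {p : ℝ} (hp : 1 < p) {s : ℝ≥0∞} (hps : ENNReal.ofReal p < s)
    {m : ℝ} (hm : 0 < m) :
    ∃ θ X Y : ℝ, 0 < θ ∧ θ < 1 ∧ 0 < X ∧ 0 < Y ∧ lorentzConst p s * X = Y / θ ∧
      (∀ g : R → ℝ≥0∞, (∀ t, 0 < t → rearrangement g μ t ≤
        if t < m then ENNReal.ofReal ((t / m) ^ (θ - 1)) else 0) →
          lorentzNorm g p s μ ≤ ENNReal.ofReal X) ∧
      ∀ (g : R → ℝ≥0∞) (S : ℝ≥0∞), (∀ t, 0 < t → t < m → S ≤ rearrangement g μ t) →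
        S * ENNReal.ofReal Y ≤ lorentzNorm g p s μ := by
  have hp0 : 0 < p := by linarith
  have hη : (0 : ℝ) < 1 - 1 / p := by
    rw [sub_pos, div_lt_one hp0]
    exact hp
  have hpinv : (0 : ℝ) < 1 / p := by positivity
  rcases eq_or_ne s ∞ with rfl | hs
  · refine ⟨1 - 1 / p, m ^ (1 / p), m ^ (1 / p), hη, by linarith, by positivity, by positivity,
      ?_, ?_, ?_⟩
    · rw [lorentzConst, if_pos rfl, Real.conjExponent]
      field_simp
    · intro g hg
      rw [lorentzNorm, if_pos rfl]
      refine iSup₂_le fun t ht => ?_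
      have ht0 : (0 : ℝ) < t := ht
      refine (mul_le_mul_right (hg t ht) _).trans ?_
      split_ifs
      · rw [ENNReal.ofReal_rpow_of_pos ht0, ← ENNReal.ofReal_mul (by positivity)]
        refine ENNReal.ofReal_le_ofReal (le_of_eq ?_)
        have e : (1 - 1 / p - 1 : ℝ) = -(1 / p) := by ring
        rw [e, Real.rpow_neg (by positivity), Real.div_rpow ht0.le hm.le]
        field_simp
      · simp
    · intro g S hS
      -- The lower bound for `g*` is available only for `t < m`, so the value at `m` is reached as a
      -- left limit.
      have hlim : Filter.Tendsto (fun t => S * ENNReal.ofReal t ^ (1 / p)) (nhdsWithin m (Iio m))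
          (nhds (S * ENNReal.ofReal m ^ (1 / p))) := by
        refine ENNReal.Tendsto.const_mul ?_ (Or.inl ?_)
        · exact (((ENNReal.continuous_rpow_const.comp ENNReal.continuous_ofReal).tendsto m).mono_left
            nhdsWithin_le_nhds)
        · exact (ENNReal.rpow_pos (ENNReal.ofReal_pos.2 hm) ENNReal.ofReal_ne_top).ne'
      rw [← ENNReal.ofReal_rpow_of_pos hm]
      refine le_of_tendsto hlim ?_
      filter_upwards [Ioo_mem_nhdsLT hm] with t ht
      rw [lorentzNorm, if_pos rfl, mul_comm]
      refine le_iSup₂_of_le t ht.1 ?_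
      gcongr
      exact hS t ht.1 ht.2
  · have hpq : p < s.toReal := (ENNReal.ofReal_lt_iff_lt_toReal hp0.le hs).1 hps
    have hqr : s.toReal.HolderConjugate s.toReal.conjExponent :=
      Real.HolderConjugate.conjExponent (hp.trans hpq)
    simp only [lorentzNorm_eq _ _ hs]
    rw [lorentzConst, if_neg hs]
    set q := s.toReal with hq
    set r := q.conjExponent with hr
    have hq0 : 0 < q := hqr.pos
    have hr0 : 0 < r := hqr.symm.pos
    have hqp : 0 < q / p := by positivity
    have hrq : r * (1 - 1 / q) = 1 := by
      have := hqr.sub_one_mul_conj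
      field_simp
      linarith
    set θ := r * (1 - 1 / p) with hθ
    have hθ0 : 0 < θ := mul_pos hr0 hη
    have hθ1 : θ < 1 := by
      rw [← hrq]
      have : 1 / q < 1 / p := one_div_lt_one_div_of_lt hp0 hpq
      exact mul_lt_mul_of_pos_left (by linarith) hr0
    have hθq : (q - 1) * θ = q - q / p := by
      rw [hθ, ← mul_assoc, hqr.sub_one_mul_conj]
      ring
    -- `X` and `Y` are the weighted `L^q` norms of `(t/m)^{θ-1}` and of `1` on `(0, m)`. The
    -- relation `hθq` turns the integrand of the first into a multiple of `t^{θ-1}`.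
    refine ⟨θ, (m ^ (q / p) / θ) ^ (1 / q), (m ^ (q / p) / (q / p)) ^ (1 / q), hθ0, hθ1,
      by positivity, by positivity, ?_, ?_, ?_⟩
    · have e1 : p.conjExponent / r = θ⁻¹ := by
        rw [hθ, Real.conjExponent]
        have : p - 1 ≠ 0 := by linarith
        field_simp
      have e2 : p / q = (q / p)⁻¹ := by rw [inv_div]
      have e3 : θ⁻¹ ^ (1 / r) * θ⁻¹ ^ (1 / q) = θ⁻¹ := by
        rw [← Real.rpow_add (inv_pos.2 hθ0), one_div, one_div, add_comm,
          hqr.inv_add_inv_eq_one, Real.rpow_one]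
      rw [e1, e2, div_eq_mul_inv (m ^ (q / p)), div_eq_mul_inv (m ^ (q / p)),
        Real.mul_rpow (by positivity) (by positivity), Real.mul_rpow (by positivity) (by positivity),
        div_eq_mul_inv _ θ]
      linear_combination ((q / p)⁻¹ ^ (1 / q) * (m ^ (q / p)) ^ (1 / q)) * e3
    · intro g hg
      rw [← ENNReal.ofReal_rpow_of_nonneg (by positivity) (by positivity)]
      gcongr
      calc ∫⁻ t in Ioi (0 : ℝ), ENNReal.ofReal (t ^ (q / p - 1)) * rearrangement g μ t ^ q
          ≤ ∫⁻ t in Ioi (0 : ℝ), (Ioc (0 : ℝ) m).indicator (fun t =>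
              ENNReal.ofReal (m ^ (q / p - θ)) * ENNReal.ofReal (t ^ (θ - 1))) t := by
            refine setLIntegral_mono' measurableSet_Ioi fun t ht => ?_
            have ht0 : (0 : ℝ) < t := ht
            have h1 := hg t ht
            split_ifs at h1 with htm
            · rw [indicator_of_mem (show t ∈ Ioc 0 m from ⟨ht0, htm.le⟩)]
              refine (mul_le_mul_right (ENNReal.rpow_le_rpow h1 hq0.le) _).trans (le_of_eq ?_)
              rw [ENNReal.ofReal_rpow_of_pos (by positivity), ← ENNReal.ofReal_mul (by positivity),
                ← ENNReal.ofReal_mul (by positivity)]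
              congr 1
              have e1 : (θ - 1) * q = -(q / p - θ) := by linarith
              rw [← Real.rpow_mul (by positivity), e1, Real.rpow_neg (by positivity),
                Real.div_rpow ht0.le hm.le, inv_div, mul_div_assoc', mul_comm, mul_div_assoc,
                ← Real.rpow_sub ht0]
              congr 2
              ring
            · rw [le_zero_iff.1 h1, ENNReal.zero_rpow_of_pos hq0, mul_zero]
              exact zero_le
        _ = ENNReal.ofReal (m ^ (q / p) / θ) := by
            rw [lintegral_indicator measurableSet_Ioc, Measure.restrict_restrict measurableSet_Ioc,
              inter_eq_left.2 Ioc_subset_Ioi_self, lintegral_const_mul _ (by fun_prop),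
              lintegral_Ioc_ofReal_rpow le_rfl hm.le hθ0, ← ENNReal.ofReal_mul (by positivity),
              Real.zero_rpow hθ0.ne', sub_zero, mul_div_assoc', ← Real.rpow_add hm, sub_add_cancel]
    · intro g S hS
      have h1 : S ^ q * ENNReal.ofReal (m ^ (q / p) / (q / p)) ≤
          ∫⁻ t in Ioi (0 : ℝ), ENNReal.ofReal (t ^ (q / p - 1)) * rearrangement g μ t ^ q := by
        have h := lintegral_Ioc_ofReal_rpow le_rfl hm.le hqp
        rw [Real.zero_rpow hqp.ne', sub_zero] at h
        rw [← h, ← setLIntegral_congr Ioo_ae_eq_Ioc, ← lintegral_const_mul _ (by fun_prop)]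
        refine le_trans ?_ (lintegral_mono_set (s := Ioo 0 m) Ioo_subset_Ioi_self)
        refine setLIntegral_mono' measurableSet_Ioo fun t ht => ?_
        rw [mul_comm]
        gcongr
        exact hS t ht.1 ht.2
      refine le_trans (le_of_eq ?_) (ENNReal.rpow_le_rpow h1 (by positivity))
      rw [ENNReal.mul_rpow_of_nonneg _ _ (by positivity), ← ENNReal.rpow_mul,
        mul_one_div_cancel hq0.ne', ENNReal.rpow_one,
        ENNReal.ofReal_rpow_of_nonneg (by positivity) (by positivity)]

/-- A step function with equimeasurable steps of decreasing-power heights has rearrangement below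
the power. -/
theorem rearrangement_sum_indicator_le {n : ℕ} {m θ : ℝ} (hm : 0 < m) (hn : 0 < n)
    (hθ1 : θ < 1) {A : Fin n → Set R} (hAμ : ∀ i, μ (A i) = ENNReal.ofReal (m / n))
    (hd : Pairwise fun i j => Disjoint (A i) (A j)) (σ : Equiv.Perm (Fin n)) {t : ℝ} (ht : 0 < t) :
    rearrangement (fun x => ∑ i, (A i).indicator
      (fun _ => ENNReal.ofReal ((((σ i : ℕ) + 1 : ℝ) / n) ^ (θ - 1))) x) μ t ≤
        if t < m then ENNReal.ofReal ((t / m) ^ (θ - 1)) else 0 := by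
  have hn0 : (0 : ℝ) < n := by exact_mod_cast hn
  set l := if t < m then ENNReal.ofReal ((t / m) ^ (θ - 1)) else 0 with hl
  rw [rearrangement_le_iff]
  set J : Finset (Fin n) := Finset.univ.filter fun i =>
    l < ENNReal.ofReal ((((σ i : ℕ) + 1 : ℝ) / n) ^ (θ - 1)) with hJ
  have hsub : {x | l < ∑ i, (A i).indicator
      (fun _ => ENNReal.ofReal ((((σ i : ℕ) + 1 : ℝ) / n) ^ (θ - 1))) x} ⊆ ⋃ i ∈ J, A i := by
    intro x hx
    by_cases hxA : ∃ i, x ∈ A i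
    · obtain ⟨i, hi⟩ := hxA
      have hx' : l < ∑ i, (A i).indicator
        (fun _ => ENNReal.ofReal ((((σ i : ℕ) + 1 : ℝ) / n) ^ (θ - 1))) x := hx
      rw [Finset.sum_eq_single i, indicator_of_mem hi] at hx'
      · simp only [mem_iUnion]
        exact ⟨i, Finset.mem_filter.2 ⟨Finset.mem_univ _, hx'⟩, hi⟩
      · intro j _ hji
        exact indicator_of_notMem (fun hj => (hd hji).le_bot ⟨hj, hi⟩) _
      · simp
    · exfalso
      push Not at hxA
      have hx' : l < ∑ i, (A i).indicator
        (fun _ => ENNReal.ofReal ((((σ i : ℕ) + 1 : ℝ) / n) ^ (θ - 1))) x := hx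
      rw [Finset.sum_eq_zero fun i _ => indicator_of_notMem (hxA i) _] at hx'
      exact not_lt_zero hx'
  -- Since `θ - 1 < 0`, the height at rank `k` exceeds `(t/m)^{θ-1}` only if `k/n < t/m`. Ranks are
  -- distinct, so there are at most `t n / m` such pieces.
  have hcard : (J.card : ℝ) ≤ t / (m / n) := by
    by_cases htm : t < m
    · have hmaps : J.card ≤ (Finset.range ⌊t / (m / n)⌋₊).card := by
        refine Finset.card_le_card_of_injOn (fun i => (σ i : ℕ)) ?_ ?_
        · intro i hi
          have h1 := (Finset.mem_filter.1 hi).2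
          rw [hl, if_pos htm, ENNReal.ofReal_lt_ofReal_iff (by positivity)] at h1
          have h2 := (Real.rpow_lt_rpow_iff_of_neg (by positivity) (by positivity)
            (by linarith)).1 h1
          simp only [Finset.coe_range, mem_Iio]
          refine Nat.lt_of_succ_le (Nat.le_floor ?_)
          rw [div_lt_div_iff₀ hn0 hm] at h2
          rw [le_div_iff₀ (by positivity)]
          push_cast
          rw [mul_div_assoc', div_le_iff₀ hn0]
          exact h2.le
        · intro i _ j _ hij
          exact σ.injective (Fin.ext hij)
      rw [Finset.card_range] at hmaps
      exact le_trans (by exact_mod_cast hmaps) (Nat.floor_le (by positivity))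
    · have h1 : (J.card : ℝ) ≤ n := by
        have := J.card_le_univ
        rw [Fintype.card_fin] at this
        exact_mod_cast this
      refine h1.trans ?_
      have hδ : 0 < m / n := div_pos hm hn0
      rw [le_div_iff₀ hδ, mul_div_cancel₀ _ hn0.ne']
      exact not_lt.1 htm
  calc distribution _ μ l ≤ μ (⋃ i ∈ J, A i) := measure_mono hsub
    _ ≤ ∑ i ∈ J, μ (A i) := measure_biUnion_finset_le _ _
    _ = ENNReal.ofReal (J.card * (m / n)) := by
      rw [Finset.sum_congr rfl fun i _ => hAμ i, Finset.sum_const, nsmul_eq_mul,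
        ENNReal.ofReal_mul (Nat.cast_nonneg _), ENNReal.ofReal_natCast]
    _ ≤ _ := ENNReal.ofReal_le_ofReal ((le_div_iff₀ (by positivity)).1 hcard)

/-- The constant in Minkowski's integral inequality for the Lorentz functional is optimal on every
nontrivial nonatomic measure space. -/
theorem exists_lt_lorentzNorm_lintegral [SigmaFinite μ] (hμ : IsNonatomic μ) (hμ0 : μ ≠ 0) {p : ℝ}
    (hp : 1 < p) {s : ℝ≥0∞} (hps : ENNReal.ofReal p < s) {C : ℝ≥0∞}
    (hC : C < ENNReal.ofReal (lorentzConst p s)) :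
    ∃ (Q : Type v) (_ : MeasurableSpace Q) (ν : Measure Q) (_ : SigmaFinite ν)
      (f : R × Q → ℝ≥0∞), Measurable f ∧ (∀ z, f z ≠ ∞) ∧
      (∀ᵐ y ∂ν, MemLorentz (fun x => f (x, y)) p s μ) ∧
      C * ∫⁻ y, lorentzNorm (fun x => f (x, y)) p s μ ∂ν <
        lorentzNorm (fun x => ∫⁻ y, f (x, y) ∂ν) p s μ := by
  obtain ⟨E, hE, hE0, hEfin⟩ : ∃ E, MeasurableSet E ∧ 0 < μ E ∧ μ E < ∞ := by
    obtain ⟨E, hE, -, h0, hfin⟩ := Measure.exists_subset_measure_lt_top (μ := μ) (r := 0)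
      MeasurableSet.univ (by
        rw [pos_iff_ne_zero]
        exact fun h => hμ0 (Measure.measure_univ_eq_zero.1 h))
    exact ⟨E, hE, h0, hfin⟩
  set m := (μ E).toReal
  have hm : 0 < m := ENNReal.toReal_pos hE0.ne' hEfin.ne
  obtain ⟨θ, X, Y, hθ0, hθ1, hX, hY, hXY, hupper, hlower⟩ :=
    exists_lorentzNorm_bounds (μ := μ) hp hps hm
  set c := lorentzConst p s
  have hCfin : C ≠ ∞ := (hC.trans_le le_top).ne
  have hCc : C.toReal < c := (ENNReal.lt_ofReal_iff_toReal_lt hCfin).1 hC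
  obtain ⟨n, hn, hnC⟩ : ∃ n : ℕ, 0 < n ∧ C.toReal < c * (1 - (n : ℝ) ^ (-θ)) := by
    have h1 : Filter.Tendsto (fun n : ℕ => c * (1 - (n : ℝ) ^ (-θ))) Filter.atTop
        (nhds (c * (1 - 0))) :=
      (((tendsto_rpow_neg_atTop hθ0).comp tendsto_natCast_atTop_atTop).const_sub 1).const_mul c
    rw [sub_zero, mul_one] at h1
    obtain ⟨n, h2, h3⟩ := ((h1.eventually_const_lt hCc).and (Filter.eventually_gt_atTop 0)).exists
    exact ⟨n, h3, h2⟩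
  have hn0 : (0 : ℝ) < n := by exact_mod_cast hn
  have : NeZero n := ⟨hn.ne'⟩
  obtain ⟨A', hAm', -, hAd', hAμ'⟩ := hμ.exists_disjoint_pieces
    (δ := ENNReal.ofReal (m / n)) ENNReal.ofReal_ne_top n E hE (by
      rw [← ENNReal.ofReal_natCast, ← ENNReal.ofReal_mul hn0.le, mul_div_cancel₀ _ hn0.ne',
        ENNReal.ofReal_toReal hEfin.ne])
  set A : Fin n → Set R := fun i => A' i
  have hAm : ∀ i, MeasurableSet (A i) := fun i => hAm' i
  have hAd : Pairwise fun i j => Disjoint (A i) (A j) := fun i j hij =>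
    hAd' i j fun h => hij (Fin.ext h)
  have hAμ : ∀ i, μ (A i) = ENNReal.ofReal (m / n) := fun i => hAμ' i i.2
  set w : Fin n → ℝ := fun j => (((j : ℕ) + 1 : ℝ) / n) ^ (θ - 1)
  have hw0 : ∀ j, 0 ≤ w j := fun j => by positivity
  -- Addition in `Fin n` is cyclic: each section permutes the same heights over the pieces, and each
  -- piece meets every height once as `y` varies. `ULift` only places `Q` in the required universe.
  set f : R × ULift.{v} (Fin n) → ℝ≥0∞ := fun z =>
    ∑ i, (A i).indicator (fun _ => ENNReal.ofReal (w (i + z.2.down))) z.1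
  let _ : MeasurableSpace (ULift.{v} (Fin n)) := ⊤
  have hint : ∀ g : ULift.{v} (Fin n) → ℝ≥0∞, ∫⁻ y, g y ∂Measure.count = ∑ k : Fin n, g ⟨k⟩ := by
    intro g
    rw [lintegral_fintype]
    simp only [Measure.count_singleton, mul_one]
    exact Fintype.sum_equiv Equiv.ulift _ _ fun _ => rfl
  have hsec : ∀ y, Measurable fun x => f (x, y) := fun y =>
    Finset.measurable_sum _ fun i _ => Measurable.indicator
      (f := fun _ => ENNReal.ofReal (w (i + y.down))) measurable_const (hAm i)
  have hnorm : ∀ y, lorentzNorm (fun x => f (x, y)) p s μ ≤ ENNReal.ofReal X := fun y =>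
    hupper _ fun t ht => rearrangement_sum_indicator_le hm hn hθ1 hAμ hAd (Equiv.addRight y.down) ht
  refine ⟨ULift.{v} (Fin n), ⊤, Measure.count, inferInstance, f,
    measurable_from_prod_countable_left hsec, ?_, ?_, ?_⟩
  · intro z
    refine ENNReal.sum_ne_top.2 fun i _ => ?_
    rw [indicator]
    split_ifs
    exacts [ENNReal.ofReal_ne_top, ENNReal.zero_ne_top]
  · exact Filter.Eventually.of_forall fun y =>
      ⟨(hsec y).aemeasurable, (hnorm y).trans_lt ENNReal.ofReal_lt_top⟩
  · set S := ∑ j, w j with hS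
    have hSle : n * (1 - (n : ℝ) ^ (-θ)) / θ ≤ S := by
      rw [hS, Fin.sum_univ_eq_sum_range (fun j : ℕ => (((j : ℝ) + 1) / n) ^ (θ - 1))]
      exact mul_one_sub_rpow_div_le_sum hθ0 hθ1 hn
    have hF : ∀ i, ∀ x ∈ A i, ENNReal.ofReal S ≤ ∫⁻ y, f (x, y) ∂Measure.count := by
      intro i x hx
      rw [hint, hS, ENNReal.ofReal_sum_of_nonneg fun j _ => hw0 j,
        ← Equiv.sum_comp (Equiv.addLeft i)]
      refine Finset.sum_le_sum fun k _ => ?_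
      refine le_trans (le_of_eq ?_)
        (Finset.single_le_sum (fun _ _ => zero_le) (Finset.mem_univ i))
      rw [indicator_of_mem hx]
      rfl
    have hrear : ∀ t, 0 < t → t < m →
        ENNReal.ofReal S ≤ rearrangement (fun x => ∫⁻ y, f (x, y) ∂Measure.count) μ t := by
      intro t _ htm
      refine le_of_forall_lt fun l hl => lt_rearrangement_iff.2 ?_
      have hU : μ (⋃ i, A i) = ENNReal.ofReal m := by
        rw [measure_iUnion hAd hAm, tsum_fintype, Finset.sum_congr rfl fun i _ => hAμ i,
          Finset.sum_const, Finset.card_univ, Fintype.card_fin, nsmul_eq_mul,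
          ← ENNReal.ofReal_natCast, ← ENNReal.ofReal_mul hn0.le, mul_div_cancel₀ _ hn0.ne']
      refine ((ENNReal.ofReal_lt_ofReal_iff hm).2 htm).trans_le ?_
      rw [← hU]
      refine measure_mono fun x hx => ?_
      obtain ⟨i, hi⟩ := mem_iUnion.1 hx
      exact hl.trans_le (hF i x hi)
    -- The `n` sections cost at most `n X`, while `F ≥ S` on a set of measure `m` gives norm at
    -- least `S Y`; `c X = Y / θ` and the choice of `n` separate the two.
    refine lt_of_le_of_lt (b := ENNReal.ofReal (C.toReal * (n * X))) ?_
      (lt_of_lt_of_le ?_ (hlower _ _ hrear))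
    · rw [hint, ENNReal.ofReal_mul ENNReal.toReal_nonneg, ENNReal.ofReal_toReal hCfin,
        ENNReal.ofReal_mul hn0.le, ENNReal.ofReal_natCast]
      gcongr
      refine (Finset.sum_le_card_nsmul _ _ _ fun k _ => hnorm ⟨k⟩).trans ?_
      rw [Finset.card_univ, Fintype.card_fin, nsmul_eq_mul]
    · have hreal : C.toReal * (n * X) < S * Y := by
        calc C.toReal * (n * X) < c * (1 - (n : ℝ) ^ (-θ)) * (n * X) := by gcongr
          _ = n * (1 - (n : ℝ) ^ (-θ)) * (c * X) := by ring
          _ = n * (1 - (n : ℝ) ^ (-θ)) / θ * Y := by rw [hXY]; ring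
          _ ≤ S * Y := by gcongr
      have hS0 : 0 ≤ S := Finset.sum_nonneg fun j _ => hw0 j
      rw [← ENNReal.ofReal_mul hS0]
      refine (ENNReal.ofReal_lt_ofReal_iff (lt_of_le_of_lt ?_ hreal)).2 hreal
      positivity

end Optimality

end LorentzSpace

theorem mainTheorem4 {R : Type u} [MeasurableSpace R] (μ : Measure R) [SigmaFinite μ]
    (hμ : LorentzSpace.IsNonatomic μ) (p : ℝ) (s : ℝ≥0∞) (hp : 1 < p)
    (hps : ENNReal.ofReal p < s) :
    -- the inequality, for every sigma-finite `(Q, ν)`, with both sides well defined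
    (∀ (Q : Type v) [MeasurableSpace Q] (ν : Measure Q) [SigmaFinite ν] (f : R × Q → ℝ≥0∞),
      AEMeasurable f (μ.prod ν) →
      (∀ᵐ y ∂ν, LorentzSpace.MemLorentz (fun x => f (x, y)) p s μ) →
        AEMeasurable (fun x => ∫⁻ y, f (x, y) ∂ν) μ ∧
        AEMeasurable (fun y => LorentzSpace.lorentzNorm (fun x => f (x, y)) p s μ) ν ∧
        LorentzSpace.lorentzNorm (fun x => ∫⁻ y, f (x, y) ∂ν) p s μ ≤
          ENNReal.ofReal (LorentzSpace.lorentzConst p s) *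
            ∫⁻ y, LorentzSpace.lorentzNorm (fun x => f (x, y)) p s μ ∂ν) ∧
    -- no smaller constant works, whatever the nontrivial space `(R, μ)` is
    (μ ≠ 0 → ∀ C : ℝ≥0∞, C < ENNReal.ofReal (LorentzSpace.lorentzConst p s) →
      ∃ (Q : Type v) (_ : MeasurableSpace Q) (ν : Measure Q) (_ : SigmaFinite ν)
        (f : R × Q → ℝ≥0∞),
        Measurable f ∧ (∀ z, f z ≠ ∞) ∧
        (∀ᵐ y ∂ν, LorentzSpace.MemLorentz (fun x => f (x, y)) p s μ) ∧
        C * ∫⁻ y, LorentzSpace.lorentzNorm (fun x => f (x, y)) p s μ ∂ν <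
          LorentzSpace.lorentzNorm (fun x => ∫⁻ y, f (x, y) ∂ν) p s μ) := by
  exact ⟨fun Q _ ν _ f hf _ => LorentzSpace.lorentzNorm_lintegral_le hf hp hps,
    fun hμ0 C hC => LorentzSpace.exists_lt_lorentzNorm_lintegral hμ hμ0 hp hps hC⟩
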